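/- Let $k$ be a field of characteristic $0$ and $\lambda\in k$. A differential algebra of weight $\lambda$ is a unital associative $k$-algebra $R$ with a $k$-linear map $d$ such that $d(1)=0$ and $d(ab)=d(a)b+a\,d(b)+\lambda d(a)d(b)$. The free (commutative) differential algebra of weight $\lambda$ on a (commutative) algebra $A$ is a (commutative) differential algebra $D$ of weight $\lambda$ with an algebra homomorphism $A\to D$ through which every algebra homomorphism from $A$ to a (commutative) differential algebra $R$ of weight $\lambda$ factors by a unique homomorphism of differential algebras $D\to R$. Let $\Delta=\{x^{(m)}\mid m\ge 0\}$, let $M(\Delta)$ be the free monoid and $[\Delta]$ the free commutative monoid on $\Delta$, and let $k\langle\Delta\rangle$ and $k[\Delta]$ be the noncommutative and the commutative polynomial algebra on $\Delta$, each with the derivation $d$ of weight $\lambda$ determined by $d(x^{(m)})=x^{(m+1)}$. Order letters by $x^{(m)}\prec x^{(m')}$ iff $m<m'$, order $M(\Delta)$ by the degree-lexicographic order, and order $[\Delta]$ by degree and then lexicographically after writing the letters of each monomial in decreasing order. Write $\overline g$ for the leading word (or monomial) of $g\neq0$, $g^\natural$ for $g$ divided by its leading coefficient, and $|w|$ for the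 number of letters of $w$ counted with multiplicity. A set $S\subset k\langle\Delta\rangle$ of monic polynomials is a differential Gröbner–Shirshov basis if for all $g,h\in S$ and $i,j\ge0$ with $d^i(g),d^j(h)\ne0$, every element $d^i(g)^\natural u-v\,d^j(h)^\natural$ with words $u,v$ such that $w=\overline{d^i(g)}u=v\overline{d^j(h)}$ and $|w|<|\overline g|+|\overline h|$, and every element $d^i(g)^\natural-a\,d^j(h)^\natural b$ with words $a,b$ such that $w=\overline{d^i(g)}=a\overline{d^j(h)}b$, is a $k$-linear combination of elements $a'd^m(s)b'$ with $s\in S$, $m\ge 0$, words $a',b'$, and $a'\overline{d^m(s)}b'\prec w$. A set $S\subset k[\Delta]$ of monic polynomials is a differential Gröbner–Shirshov basis if for all $g,h\in S$ and $i,j\ge0$ with $d^i(g),d^j(h)\ne0$, every element $d^i(g)^\natural u-d^j(h)^\natural v$ with monomials $u,v$ such that $w=\overline{d^i(g)}u=\overline{d^j(h)}v$ and $|w|<|\overline g|+|\overline h|$ is a $k$-linear combination of elements $d^m(s)u'$ with $s\in S$, $m\ge 0$, $u'$ a monomial, and $\overline{d^m(s)}u'\prec w$. In both cases $\mathrm{DIrr}(S)$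 denotes the set of words (monomials) that are not divisible by any $\overline{d^i(s)}$ with $s\in S$, $i\ge0$, $d^i(s)\neq0$ (for words, $v$ divides $w$ if $w=avb$ for some words $a,b$). Let $A=k[x]/(f)$ with $f\in k[x]$ of degree $n>0$. (1) For every $\lambda$, the algebra $k\langle\Delta\rangle/\big(d^m(f(x^{(0)}))\mid m\ge0\big)$, with the derivation induced by $d$ and the homomorphism $A\to k\langle\Delta\rangle/(\dots)$ sending the class of $x$ to the class of $x^{(0)}$, is the free differential algebra of weight $\lambda$ on $A$. The ideal $\big(d^m(f(x^{(0)}))\mid m\ge 0\big)$ is the differential ideal generated by $f(x^{(0)})$, equivalently by $\hat S=\{f(x^{(0)})^\natural\}$ (which is $\{f(x^{(0)})\}$ if $f$ is monic), and $\hat S$ is a differential Gröbner–Shirshov basis. Moreover $$\mathrm{DIrr}(\hat S)=\Big\{w\in M(\Delta)\ \Big|\ x^{(m)}\big(x^{(m(1-\delta_{\lambda,0}))}\big)^{n-1}\text{ does not divide } w\text{ for any } m\ge0\Big\},$$ and the image of this set is a $k$-basis of the free differential algebra. (2) For every $\lambda$, the algebra $k[\Delta]/\big(d^m(f(x^{(0)}))\mid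 m\ge0\big)$, with the induced derivation and the homomorphism sending the class of $x$ to the class of $x^{(0)}$, is the free commutative differential algebra of weight $\lambda$ on $A$, and $\big(d^m(f(x^{(0)}))\mid m\ge 0\big)$ is the differential ideal generated by $f(x^{(0)})$, equivalently by $\hat S=\{f(x^{(0)})^\natural\}$ (which is $\{f(x^{(0)})\}$ if $f$ is monic). If $\lambda\ne0$, then $\hat S$ is a differential Gröbner–Shirshov basis in $k[\Delta]$, $$\mathrm{DIrr}(\hat S)=\Big\{\prod_{i\ge0}(x^{(i)})^{n_i}\ \Big|\ 0\le n_i\le n-1,\ n_i=0\text{ for almost all } i\Big\},$$ and the image of this set is a $k$-basis of the free commutative differential algebra. -/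

import Mathlib

open Polynomial

universe u v

namespace WDiff

/-! ### Differential algebras of weight `lam` and the free differential algebra on an algebra -/

/-- `d` is a derivation of weight `lam` on the unital associative `k`-algebra `R`:
`d 1 = 0` and `d (x y) = d x y + x d y + lam d x d y`. -/
structure IsWeightedDerivation {k R : Type*} [Field k] [Ring R] [Algebra k R]
    (lam : k) (d : R →ₗ[k] R) : Prop where
  map_one : d 1 = 0
  leibniz : ∀ x y : R, d (x * y) = d x * y + x * d y + lam • (d x * d y)

/-- `(D, d)` with `i : A → D` is the free differential algebra of weight `lam` on the algebra `A`
(universal property, tested on differential algebras in an arbitrary universe). -/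
structure IsFreeDiffAlgebra.{v', u', w, w'} {k : Type u'} [Field k] (lam : k)
    {A : Type w} [Ring A] [Algebra k A] {D : Type w'} [Ring D] [Algebra k D]
    (d : D →ₗ[k] D) (i : A →ₐ[k] D) : Prop where
  isWeightedDerivation : IsWeightedDerivation lam d
  existsUnique_hom : ∀ (R : Type v') [Ring R] [Algebra k R] (dR : R →ₗ[k] R),
    IsWeightedDerivation lam dR → ∀ φ : A →ₐ[k] R,
      ∃! ψ : D →ₐ[k] R, (∀ x, ψ (d x) = dR (ψ x)) ∧ ψ.comp i = φ

/-- `(D, d)` with `i : A → D` is the free commutative differential algebra of weight `lam` on the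
commutative algebra `A`. -/
structure IsFreeCommDiffAlgebra.{v', u', w, w'} {k : Type u'} [Field k] (lam : k)
    {A : Type w} [CommRing A] [Algebra k A] {D : Type w'} [CommRing D] [Algebra k D]
    (d : D →ₗ[k] D) (i : A →ₐ[k] D) : Prop where
  isWeightedDerivation : IsWeightedDerivation lam d
  existsUnique_hom : ∀ (R : Type v') [CommRing R] [Algebra k R] (dR : R →ₗ[k] R),
    IsWeightedDerivation lam dR → ∀ φ : A →ₐ[k] R,
      ∃! ψ : D →ₐ[k] R, (∀ x, ψ (d x) = dR (ψ x)) ∧ ψ.comp i = φ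

/-- A finite nonempty set has a largest element for a transitive trichotomous relation. -/
theorem exists_max {α : Type*} (r : α → α → Prop) (tri : ∀ a b, r a b ∨ a = b ∨ r b a)
    (trans : ∀ a b c, r a b → r b c → r a c) (s : Finset α) (hs : s.Nonempty) :
    ∃ w ∈ s, ∀ v ∈ s, v = w ∨ r v w := by
  induction hs using Finset.Nonempty.cons_induction with
  | singleton a => exact ⟨a, by simp⟩
  | cons a s ha hs ih =>
    obtain ⟨w, hw, h⟩ := ih
    rcases tri a w with hlt | heq | hlt
    · refine ⟨w, by simp [hw], fun v hv => ?_⟩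
      rcases Finset.mem_cons.1 hv with rfl | hv
      · exact Or.inr hlt
      · exact h v hv
    · exact absurd (heq ▸ hw) ha
    · refine ⟨a, by simp, fun v hv => ?_⟩
      rcases Finset.mem_cons.1 hv with rfl | hv
      · exact Or.inl rfl
      · rcases h v hv with rfl | hvw
        · exact Or.inr hlt
        · exact Or.inr (trans _ _ _ hvw hlt)

/-! ### Noncommutative differential polynomials in one variable `x`

The letter `x^(m)` is `m : ℕ`, so that words are elements of `FreeMonoid ℕ` and noncommutative
differential polynomials are elements of `FreeAlgebra k ℕ`. -/

section NC

variable {k : Type*} [Field k]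

/-- The element of the free algebra given by a word. -/
noncomputable def word (w : FreeMonoid ℕ) : FreeAlgebra k ℕ :=
  FreeMonoid.lift (FreeAlgebra.ι k) w

/-- The coefficient of a word in a noncommutative polynomial. -/
noncomputable def coeff (f : FreeAlgebra k ℕ) (w : FreeMonoid ℕ) : k :=
  (FreeAlgebra.basisFreeMonoid k ℕ).repr f w

/-- The recursion `d 1 = 0`,
`d (u w) = d u w + u d w + lam d u d w` with `d x^(m) = x^(m+1)`, for `u` a letter. -/
noncomputable def derivList (lam : k) : List ℕ → FreeAlgebra k ℕ
  | [] => 0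
  | m :: l =>
      FreeAlgebra.ι k (m + 1) * word (FreeMonoid.ofList l)
        + FreeAlgebra.ι k m * derivList lam l
        + lam • (FreeAlgebra.ι k (m + 1) * derivList lam l)

/-- The derivation of weight `lam` on noncommutative differential polynomials. -/
noncomputable def deriv (lam : k) : FreeAlgebra k ℕ →ₗ[k] FreeAlgebra k ℕ :=
  (FreeAlgebra.basisFreeMonoid k ℕ).constr k fun w => derivList lam w.toList

theorem basis_apply (w : FreeMonoid ℕ) :
    FreeAlgebra.basisFreeMonoid k ℕ w = word w := by
  simp [FreeAlgebra.basisFreeMonoid, word, FreeAlgebra.equivMonoidAlgebraFreeMonoid]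

theorem deriv_word (lam : k) (w : FreeMonoid ℕ) :
    deriv lam (word w) = derivList lam w.toList := by
  rw [← basis_apply, deriv, Module.Basis.constr_basis]

theorem word_of_mul (m : ℕ) (w : FreeMonoid ℕ) :
    word (FreeMonoid.of m * w) = FreeAlgebra.ι k m * word w := by
  simp [word]

theorem derivList_append (lam : k) (l l' : List ℕ) :
    derivList lam (l ++ l') =
      derivList lam l * word (FreeMonoid.ofList l')
        + word (FreeMonoid.ofList l) * derivList lam l'
        + lam • (derivList lam l * derivList lam l') := by
  induction l with
  | nil => simp [derivList, word]
  | cons m l ih =>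
    have h1 : ∀ t : List ℕ, word (k := k) (FreeMonoid.ofList (m :: t)) =
        FreeAlgebra.ι k m * word (FreeMonoid.ofList t) := fun t => word_of_mul m _
    have h2 : word (k := k) (FreeMonoid.ofList (l ++ l')) =
        word (FreeMonoid.ofList l) * word (FreeMonoid.ofList l') := by
      simp [word]
    simp only [List.cons_append, derivList, ih, h1, h2, mul_add, add_mul, mul_assoc, smul_add,
      mul_smul_comm, smul_mul_assoc]
    abel

theorem deriv_ι (lam : k) (m : ℕ) :
    deriv lam (FreeAlgebra.ι k m) = FreeAlgebra.ι k (m + 1) := by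
  have h : FreeAlgebra.ι k m = word (FreeMonoid.of m) := by simp [word]
  rw [h, deriv_word]
  simp [derivList, word, FreeMonoid.toList_of]

theorem isWeightedDerivation_deriv (lam : k) : IsWeightedDerivation lam (deriv lam) where
  map_one := by
    have h : (1 : FreeAlgebra k ℕ) = word 1 := by simp [word]
    rw [h, deriv_word]
    rfl
  leibniz x y := by
    have hspan : ∀ z : FreeAlgebra k ℕ,
        z ∈ Submodule.span k (Set.range (FreeAlgebra.basisFreeMonoid k ℕ)) := by
      intro z
      rw [(FreeAlgebra.basisFreeMonoid k ℕ).span_eq]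
      trivial
    induction hspan x using Submodule.span_induction with
    | zero => simp
    | add p q _ _ hp hq =>
      simp only [add_mul, map_add, hp, hq, smul_add]
      abel
    | smul c p _ hp => simp only [smul_mul_assoc, map_smul, hp, smul_add, smul_comm c lam]
    | mem x hx =>
      obtain ⟨u, rfl⟩ := hx
      induction hspan y using Submodule.span_induction with
      | zero => simp
      | add p q _ _ hp hq =>
        simp only [mul_add, map_add, hp, hq, smul_add]
        abel
      | smul c p _ hp => simp only [mul_smul_comm, map_smul, hp, smul_add, smul_comm c lam]
      | mem y hy =>
        obtain ⟨v, rfl⟩ := hy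
        have h : word (k := k) u * word v = word (u * v) := by simp [word]
        rw [basis_apply, basis_apply, h, deriv_word, deriv_word, deriv_word]
        exact derivList_append lam u.toList v.toList

/-- The deg-lex order on words: shorter words come first, words of the same length are compared
lexicographically, with `x^(m) < x^(n)` for `m < n`. -/
def WordLT (u v : FreeMonoid ℕ) : Prop :=
  List.Shortlex (· < ·) u.toList v.toList

/-- `w` is the largest word occurring in `f`. -/
def IsLeadWord (f : FreeAlgebra k ℕ) (w : FreeMonoid ℕ) : Prop :=
  coeff f w ≠ 0 ∧ ∀ v, coeff f v ≠ 0 → v = w ∨ WordLT v w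

theorem IsLeadWord.unique {f : FreeAlgebra k ℕ} {v w : FreeMonoid ℕ}
    (hv : IsLeadWord f v) (hw : IsLeadWord f w) : v = w := by
  rcases hw.2 v hv.1 with h | h
  · exact h
  rcases hv.2 w hw.1 with h' | h'
  · exact h'.symm
  · exact absurd h' (Std.Asymm.asymm (r := List.Shortlex (· < ·)) _ _ h)

theorem exists_isLeadWord {f : FreeAlgebra k ℕ} (hf : f ≠ 0) : ∃ w, IsLeadWord f w := by
  have tri : ∀ a b, WordLT a b ∨ a = b ∨ WordLT b a := by
    intro a b
    by_contra! hc
    exact hc.2.1 (Std.Trichotomous.trichotomous (r := List.Shortlex (· < ·)) a b hc.1 hc.2.2)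
  have trans : ∀ x y z, WordLT x y → WordLT y z → WordLT x z := by
    intro x y z hxy hyz
    rcases List.shortlex_def.1 hxy with h1 | h1 <;> rcases List.shortlex_def.1 hyz with h2 | h2
    · exact List.shortlex_def.2 (Or.inl (h1.trans h2))
    · exact List.shortlex_def.2 (Or.inl (h2.1 ▸ h1))
    · exact List.shortlex_def.2 (Or.inl (h1.1 ▸ h2))
    · exact List.shortlex_def.2 (Or.inr ⟨h1.1.trans h2.1,
        (List.lt_trans (h1.2 : x.toList < y.toList) (h2.2 : y.toList < z.toList) :
          x.toList < z.toList)⟩)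
  have hne : ((FreeAlgebra.basisFreeMonoid k ℕ).repr f).support.Nonempty := by
    rw [Finsupp.support_nonempty_iff]
    simpa using hf
  obtain ⟨w, hw, h⟩ := exists_max WordLT tri trans _ hne
  exact ⟨w, Finsupp.mem_support_iff.1 hw, fun v hv => h v (Finsupp.mem_support_iff.2 hv)⟩

open Classical in
/-- The leading word of `f` (with the default value `1` for `f = 0`). -/
noncomputable def leadWord (f : FreeAlgebra k ℕ) : FreeMonoid ℕ :=
  if h : ∃ w, IsLeadWord f w then h.choose else 1

theorem isLeadWord_leadWord {f : FreeAlgebra k ℕ} (hf : f ≠ 0) : IsLeadWord f (leadWord f) := by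
  have h := exists_isLeadWord hf
  rw [leadWord, dif_pos h]
  exact h.choose_spec

/-- The leading coefficient. -/
noncomputable def leadCoeff (f : FreeAlgebra k ℕ) : k :=
  coeff f (leadWord f)

/-- The monic multiple of a nonzero polynomial. -/
noncomputable def monicPart (f : FreeAlgebra k ℕ) : FreeAlgebra k ℕ :=
  (leadCoeff f)⁻¹ • f

/-- The differential ideal generated by `S`: the smallest two-sided ideal that contains `S` and is
stable under the derivation. -/
noncomputable def diffIdeal (lam : k) (S : Set (FreeAlgebra k ℕ)) :
    TwoSidedIdeal (FreeAlgebra k ℕ) :=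
  sInf {I | (∀ s ∈ S, s ∈ I) ∧ ∀ x ∈ I, deriv lam x ∈ I}

/-- `p` is trivial modulo `(S, w)`: it is a linear combination of elements `a d^m(s) b` with
`s ∈ S` and words `a`, `b` such that `a (leading word of d^m(s)) b` is smaller than `w`. -/
def TrivialMod (lam : k) (S : Set (FreeAlgebra k ℕ)) (w : FreeMonoid ℕ)
    (p : FreeAlgebra k ℕ) : Prop :=
  p ∈ Submodule.span k {t | ∃ s ∈ S, ∃ (m : ℕ) (a b : FreeMonoid ℕ),
    WordLT (a * leadWord ((deriv lam)^[m] s) * b) w ∧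
      t = word a * (deriv lam)^[m] s * word b}

/-- `S` is a differential Gröbner-Shirshov basis: it consists of monic polynomials, and all the
intersection compositions and inclusion compositions of elements of `S` are trivial. -/
structure IsGSBasis (lam : k) (S : Set (FreeAlgebra k ℕ)) : Prop where
  monic : ∀ f ∈ S, leadCoeff f = 1
  intersection : ∀ f ∈ S, ∀ g ∈ S, ∀ (i j : ℕ) (u v w : FreeMonoid ℕ),
    (deriv lam)^[i] f ≠ 0 → (deriv lam)^[j] g ≠ 0 →
    w = leadWord ((deriv lam)^[i] f) * u → w = v * leadWord ((deriv lam)^[j] g) →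
    w.length < (leadWord f).length + (leadWord g).length →
    TrivialMod lam S w
      (monicPart ((deriv lam)^[i] f) * word u - word v * monicPart ((deriv lam)^[j] g))
  inclusion : ∀ f ∈ S, ∀ g ∈ S, ∀ (i j : ℕ) (a b w : FreeMonoid ℕ),
    (deriv lam)^[i] f ≠ 0 → (deriv lam)^[j] g ≠ 0 →
    w = leadWord ((deriv lam)^[i] f) → w = a * leadWord ((deriv lam)^[j] g) * b →
    TrivialMod lam S w
      (monicPart ((deriv lam)^[i] f) - word a * monicPart ((deriv lam)^[j] g) * word b)

/-- The differential `S`-irreducible words: those that are not of the form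
`a (leading word of d^i(s)) b` with `s ∈ S`. -/
def DIrr (lam : k) (S : Set (FreeAlgebra k ℕ)) : Set (FreeMonoid ℕ) :=
  {w | ¬ ∃ s ∈ S, ∃ (i : ℕ) (a b : FreeMonoid ℕ),
    (deriv lam)^[i] s ≠ 0 ∧ w = a * leadWord ((deriv lam)^[i] s) * b}

end NC

/-! ### Commutative differential polynomials in one variable

The variable `x^(m)` is `MvPolynomial.X m`, and monomials are exponent vectors `ℕ →₀ ℕ`. -/

section Comm

variable {k : Type*} [Field k]

/-- The algebra homomorphism `p ↦ p + d(p) e` to the extension by `e` with `e ^ 2 = lam e`,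
sending `x^(m)` to `x^(m) + x^(m+1) e`. -/
noncomputable def cDerivHom (lam : k) : MvPolynomial ℕ k →ₐ[k]
    QuadraticAlgebra (MvPolynomial ℕ k) 0 (MvPolynomial.C lam) :=
  MvPolynomial.aeval fun m => ⟨MvPolynomial.X m, MvPolynomial.X (m + 1)⟩

/-- The derivation of weight `lam` on commutative differential polynomials; it is the only one
with `d x^(m) = x^(m+1)`, see the lemmas below. -/
noncomputable def cDeriv (lam : k) : MvPolynomial ℕ k →ₗ[k] MvPolynomial ℕ k where
  toFun p := (cDerivHom lam p).im
  map_add' p q := by simp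
  map_smul' c p := by simp

theorem cDeriv_X (lam : k) (m : ℕ) :
    cDeriv lam (MvPolynomial.X m) = MvPolynomial.X (m + 1) := by
  simp [cDeriv, cDerivHom]

theorem cDerivHom_re (lam : k) (p : MvPolynomial ℕ k) : (cDerivHom lam p).re = p := by
  induction p using MvPolynomial.induction_on with
  | C a =>
    have h := (cDerivHom lam).commutes a
    rw [MvPolynomial.algebraMap_eq] at h
    exact congrArg QuadraticAlgebra.re h
  | add p q hp hq => simp [hp, hq]
  | mul_X p n hp =>
    simp only [cDerivHom] at hp
    simp [hp, cDerivHom]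

theorem isWeightedDerivation_cDeriv (lam : k) :
    IsWeightedDerivation lam (cDeriv lam) where
  map_one := congrArg QuadraticAlgebra.im (map_one (cDerivHom lam))
  leibniz p q := by
    simp [cDeriv, cDerivHom_re, MvPolynomial.smul_eq_C_mul]
    ring

/-- The order on monomials: first by total degree, and monomials of the same degree are compared
lexicographically after listing the letters of each in decreasing order. Two such lists first
differ at the largest letter whose multiplicities differ. -/
def MonoLT (u v : ℕ →₀ ℕ) : Prop :=
  u.degree < v.degree ∨
    (u.degree = v.degree ∧ ∃ m, u m < v m ∧ ∀ j, m < j → u j = v j)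

/-- `w` is the largest monomial occurring in `f`. -/
def IsLeadMono (f : MvPolynomial ℕ k) (w : ℕ →₀ ℕ) : Prop :=
  f.coeff w ≠ 0 ∧ ∀ v, f.coeff v ≠ 0 → v = w ∨ MonoLT v w

theorem MonoLT.trichotomous (u v : ℕ →₀ ℕ) : MonoLT u v ∨ u = v ∨ MonoLT v u := by
  rcases lt_trichotomy u.degree v.degree with h | h | h
  · exact Or.inl (Or.inl h)
  · by_cases huv : u = v
    · exact Or.inr (Or.inl huv)
    have hne : (u.neLocus v).Nonempty := Finsupp.nonempty_neLocus_iff.2 huv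
    have hm := Finset.max'_mem _ hne
    have hj : ∀ j, (u.neLocus v).max' hne < j → u j = v j := by
      intro j hj
      by_contra hc
      exact absurd ((u.neLocus v).le_max' j (Finsupp.mem_neLocus.2 hc)) (not_le.2 hj)
    rcases lt_or_gt_of_ne (Finsupp.mem_neLocus.1 hm) with hlt | hlt
    · exact Or.inl (Or.inr ⟨h, _, hlt, hj⟩)
    · exact Or.inr (Or.inr (Or.inr ⟨h.symm, _, hlt, fun j hj' => (hj j hj').symm⟩))
  · exact Or.inr (Or.inr (Or.inl h))

theorem MonoLT.trans (u v w : ℕ →₀ ℕ) (huv : MonoLT u v) (hvw : MonoLT v w) : MonoLT u w := by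
  rcases huv with h1 | ⟨h1, m, hm, hm'⟩ <;> rcases hvw with h2 | ⟨h2, l, hl, hl'⟩
  · exact Or.inl (h1.trans h2)
  · exact Or.inl (h2 ▸ h1)
  · exact Or.inl (h1 ▸ h2)
  · refine Or.inr ⟨h1.trans h2, max m l, ?_, fun j hj => ?_⟩
    · rcases lt_trichotomy m l with h | rfl | h
      · rw [max_eq_right h.le, hm' l h]
        exact hl
      · rw [max_self]
        exact hm.trans hl
      · rw [max_eq_left h.le, ← hl' m h]
        exact hm
    · rw [hm' j ((le_max_left _ _).trans_lt hj), hl' j ((le_max_right _ _).trans_lt hj)]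

theorem MonoLT.irrefl (u : ℕ →₀ ℕ) : ¬ MonoLT u u := by
  rintro (h | ⟨_, m, hm, _⟩)
  · exact lt_irrefl _ h
  · exact lt_irrefl _ hm

theorem IsLeadMono.unique {f : MvPolynomial ℕ k} {v w : ℕ →₀ ℕ}
    (hv : IsLeadMono f v) (hw : IsLeadMono f w) : v = w := by
  rcases hw.2 v hv.1 with h | h
  · exact h
  rcases hv.2 w hw.1 with h' | h'
  · exact h'.symm
  · exact absurd (MonoLT.trans _ _ _ h h') (MonoLT.irrefl v)

open Classical in
/-- The leading monomial of `f` (with the default value `1` for `f = 0`). -/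
noncomputable def leadMono (f : MvPolynomial ℕ k) : ℕ →₀ ℕ :=
  if h : ∃ w, IsLeadMono f w then h.choose else 0

theorem isLeadMono_leadMono {f : MvPolynomial ℕ k} (hf : f ≠ 0) :
    IsLeadMono f (leadMono f) := by
  have h : ∃ w, IsLeadMono f w := by
    obtain ⟨w, hw, h⟩ := exists_max MonoLT MonoLT.trichotomous MonoLT.trans f.support
      (MvPolynomial.support_nonempty.2 hf)
    exact ⟨w, MvPolynomial.mem_support_iff.1 hw,
      fun v hv => h v (MvPolynomial.mem_support_iff.2 hv)⟩
  rw [leadMono, dif_pos h]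
  exact h.choose_spec

/-- The leading coefficient. -/
noncomputable def cLeadCoeff (f : MvPolynomial ℕ k) : k :=
  f.coeff (leadMono f)

/-- The monic multiple of a nonzero polynomial. -/
noncomputable def cMonicPart (f : MvPolynomial ℕ k) : MvPolynomial ℕ k :=
  (cLeadCoeff f)⁻¹ • f

/-- A monomial as a polynomial. -/
noncomputable def mono (w : ℕ →₀ ℕ) : MvPolynomial ℕ k :=
  MvPolynomial.monomial w 1

/-- The differential ideal generated by `S`. -/
noncomputable def cDiffIdeal (lam : k) (S : Set (MvPolynomial ℕ k)) :
    Ideal (MvPolynomial ℕ k) :=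
  sInf {I | (∀ s ∈ S, s ∈ I) ∧ ∀ x ∈ I, cDeriv lam x ∈ I}

/-- `p` is trivial modulo `(S, w)`: it is a linear combination of elements `d^m(s) u` with
`s ∈ S` and a monomial `u` such that `(leading monomial of d^m(s)) u` is smaller than `w`. -/
def CTrivialMod (lam : k) (S : Set (MvPolynomial ℕ k)) (w : ℕ →₀ ℕ)
    (p : MvPolynomial ℕ k) : Prop :=
  p ∈ Submodule.span k {t | ∃ s ∈ S, ∃ (m : ℕ) (u : ℕ →₀ ℕ),
    MonoLT (leadMono ((cDeriv lam)^[m] s) + u) w ∧ t = (cDeriv lam)^[m] s * mono u}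

/-- `S` is a differential Gröbner-Shirshov basis in the commutative sense: it consists of monic
polynomials, and all compositions of elements of `S` are trivial. -/
structure IsCGSBasis (lam : k) (S : Set (MvPolynomial ℕ k)) : Prop where
  monic : ∀ f ∈ S, cLeadCoeff f = 1
  composition : ∀ f ∈ S, ∀ g ∈ S, ∀ (i j : ℕ) (u v w : ℕ →₀ ℕ),
    (cDeriv lam)^[i] f ≠ 0 → (cDeriv lam)^[j] g ≠ 0 →
    w = leadMono ((cDeriv lam)^[i] f) + u → w = leadMono ((cDeriv lam)^[j] g) + v →
    w.degree < (leadMono f).degree + (leadMono g).degree →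
    CTrivialMod lam S w
      (cMonicPart ((cDeriv lam)^[i] f) * mono u - cMonicPart ((cDeriv lam)^[j] g) * mono v)

/-- The differential `S`-irreducible monomials. -/
def CDIrr (lam : k) (S : Set (MvPolynomial ℕ k)) : Set (ℕ →₀ ℕ) :=
  {w | ¬ ∃ s ∈ S, ∃ (i : ℕ) (u : ℕ →₀ ℕ),
    (cDeriv lam)^[i] s ≠ 0 ∧ w = leadMono ((cDeriv lam)^[i] s) + u}

end Comm

/-! ### The presentations for one generator with one relation -/

section Presentation

variable {k : Type*} [Field k]

/-- `f(x^(0))` as a noncommutative differential polynomial. -/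
noncomputable def rel (f : k[X]) : FreeAlgebra k ℕ :=
  aeval (FreeAlgebra.ι k 0) f

/-- The two-sided ideal generated by `d^m(f(x^(0)))`, `m ≥ 0`. -/
noncomputable def relIdeal (lam : k) (f : k[X]) : TwoSidedIdeal (FreeAlgebra k ℕ) :=
  TwoSidedIdeal.span (Set.range fun m : ℕ => (deriv lam)^[m] (rel f))

/-- The quotient of the noncommutative differential polynomials by that ideal. -/
abbrev RelQuotient (lam : k) (f : k[X]) : Type _ :=
  (relIdeal lam f).ringCon.Quotient

/-- The quotient map. -/
noncomputable def proj (lam : k) (f : k[X]) : FreeAlgebra k ℕ →ₐ[k] RelQuotient lam f :=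
  (relIdeal lam f).ringCon.mkₐ k

/-- `f(x^(0))` as a commutative differential polynomial. -/
noncomputable def cRel (f : k[X]) : MvPolynomial ℕ k :=
  aeval (MvPolynomial.X 0) f

/-- The ideal generated by `d^m(f(x^(0)))`, `m ≥ 0`. -/
noncomputable def cRelIdeal (lam : k) (f : k[X]) : Ideal (MvPolynomial ℕ k) :=
  Ideal.span (Set.range fun m : ℕ => (cDeriv lam)^[m] (cRel f))

/-- The quotient of the commutative differential polynomials by that ideal. -/
abbrev CRelQuotient (lam : k) (f : k[X]) : Type _ :=
  MvPolynomial ℕ k ⧸ cRelIdeal lam f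

/-- The quotient map. -/
noncomputable def cProj (lam : k) (f : k[X]) : MvPolynomial ℕ k →ₐ[k] CRelQuotient lam f :=
  Ideal.Quotient.mkₐ k (cRelIdeal lam f)

end Presentation

end WDiff

/-! A homomorphism from `k[x]/(f)` to `R` is an element `r` with `f(r) = 0`, and a differential
homomorphism out of the polynomials in the `x^(m)` is forced to send `x^(m)` to the `m`-th
derivative of `r`. It kills every derivative of `f(x^(0))`, and by the Leibniz rule these
derivatives generate a differentially stable ideal. This gives both presentations
(`existsUnique_hom_of_generators`, `map_iterate_aeval_eq_zero`).

For the bases, let `G` be the monic multiple of `f(x^(0))` and `D_m` its `m`-th derivative. If `lam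
≠ 0`, then `σ = 1 + lam d` is an algebra endomorphism with `σ(x^(m)) = x^(m) + lam x^(m+1)`. It
therefore shifts leading words, and since `d = lam⁻¹ (σ - 1)`, the leading word of `D_m` is
`(x^(m))^n`. If `lam = 0`, noncommutatively, the largest word arises by always differentiating the
first letter: `x^(m) (x^(0))^(n-1)`, with coefficient 1.

All these words have length `n`, so inclusions are trivial and only proper overlaps matter. For `lam
≠ 0` an overlap forces `i = j`, and its composition is, up to a scalar, the commutator of `D_i` with
a power of `x^(i)`. For `lam = 0` the second word must be `(x^(0))^n`. When `i = 0` both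
compositions vanish, because `G` is a polynomial in `x^(0)`; applying `σ`, respectively `d`, carries
triviality from `i` to `i + 1` (`overlap_mem_smallSpan`, `overlap_zero_mem_smallSpan`). In the
commutative case with `lam ≠ 0` the leading monomials `(x^(m))^n` are pairwise coprime, so there are
no nonzero compositions to check.

Non-overlapping multiples have trivial compositions for formal reasons (`disjoint_composition`).
Once all compositions are trivial, a triangularity argument over a well-founded order gives the
basis of the quotient (`exists_basis_of_compositions`). -/

namespace WDiff

/-! ### Bases of quotients from leading terms -/

/-- Vectors with pairwise distinct leading terms with respect to a basis indexed by a well-ordered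
set form a basis. -/
theorem linearIndependent_of_leading {k V ι : Type*} [Field k] [AddCommGroup V] [Module k V]
    (b : Module.Basis ι k V) (r : ι → ι → Prop) (wf : WellFounded r)
    (tri : ∀ i j, r i j ∨ i = j ∨ r j i) (trans : ∀ i j l, r i j → r j l → r i l)
    (e : ι → V) (he : ∀ i, e i - b i ∈ Submodule.span k (b '' {j | r j i})) :
    LinearIndependent k e := by
  have irr : ∀ i, ¬ r i i := fun i h => wf.asymmetric _ _ h h
  -- Only indices below `i` distinguish `e i` from `b i`. So at the maximal index of a relation, no
  -- other term of the relation contributes.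
  have hrepr : ∀ i w, ¬ r w i → b.repr (e i) w = b.repr (b i) w := by
    intro i w hw
    have h : b.repr (e i - b i) w = 0 := by
      by_contra hne
      have := (Module.Basis.mem_span_image b).1 (he i)
      exact hw (this (Finsupp.mem_support_iff.2 hne))
    rw [map_sub, Finsupp.sub_apply, sub_eq_zero] at h
    exact h
  rw [linearIndependent_iff]
  intro l hl
  by_contra hne
  obtain ⟨w, hw, hmax⟩ := exists_max r tri trans l.support (Finsupp.support_nonempty_iff.2 hne)
  have h0 : b.repr (Finsupp.linearCombination k e l) w = 0 := by rw [hl]; simp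
  rw [Finsupp.linearCombination_apply, Finsupp.sum, map_sum, Finsupp.finsetSum_apply,
    Finset.sum_eq_single w] at h0
  · rw [map_smul, Finsupp.smul_apply, hrepr w w (irr w)] at h0
    simp only [Module.Basis.repr_self, Finsupp.single_eq_same, smul_eq_mul, mul_one] at h0
    exact (Finsupp.mem_support_iff.1 hw) h0
  · intro v hv hvw
    have hr := (hmax v hv).resolve_left hvw
    rw [map_smul, Finsupp.smul_apply, hrepr v w (fun h => wf.asymmetric _ _ h hr)]
    simp [hvw]
  · exact fun h => absurd hw h

/-- Well-founded induction: `b i` is `e i` minus a combination of smaller `b j`, which already lie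
in the span. -/
theorem span_eq_top_of_leading {k V ι : Type*} [Field k] [AddCommGroup V] [Module k V]
    (b : Module.Basis ι k V) (r : ι → ι → Prop) (wf : WellFounded r)
    (e : ι → V) (he : ∀ i, e i - b i ∈ Submodule.span k (b '' {j | r j i})) :
    Submodule.span k (Set.range e) = ⊤ := by
  rw [eq_top_iff, ← b.span_eq, Submodule.span_le]
  rintro _ ⟨i, rfl⟩
  induction i using wf.induction with
  | _ i ih =>
    have h : Submodule.span k (b '' {j | r j i}) ≤ Submodule.span k (Set.range e) := by
      rw [Submodule.span_le]
      rintro _ ⟨j, hj, rfl⟩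
      exact ih j hj
    have h' := Submodule.sub_mem _ (Submodule.subset_span (Set.mem_range_self i)) (h (he i))
    simpa using h'

/-- If all the compositions of the family `v` are trivial, then the basis vectors that are not
leading terms of the family give a basis of the quotient by its span. -/
theorem exists_basis_of_compositions {k V Q ι τ : Type*} [Field k] [AddCommGroup V] [Module k V]
    [AddCommGroup Q] [Module k Q] (b : Module.Basis ι k V) (r : ι → ι → Prop)
    (wf : WellFounded r) (tri : ∀ i j, r i j ∨ i = j ∨ r j i)
    (trans : ∀ i j l, r i j → r j l → r i l) (v : τ → V) (l : τ → ι)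
    (hlead : ∀ t, v t - b (l t) ∈ Submodule.span k (b '' {j | r j (l t)}))
    (hcomp : ∀ t t', l t = l t' → v t - v t' ∈ Submodule.span k (v '' {s | r (l s) (l t)}))
    (π : V →ₗ[k] Q) (hπ : Function.Surjective π)
    (hker : LinearMap.ker π = Submodule.span k (Set.range v))
    (I : Set ι) (hI : ∀ j, j ∈ I ↔ j ∉ Set.range l) :
    ∃ B : Module.Basis I k Q, ∀ j, B j = π (b j) := by
  classical
  -- One member of the family is kept for each leading index, and the remaining indices keep their
  -- basis vector. The result is unitriangular over `b`, hence a basis adapted to the span of the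
  -- family.
  let e : ι → V := fun i => if h : ∃ t, l t = i then v h.choose else b i
  have he : ∀ i, e i - b i ∈ Submodule.span k (b '' {j | r j i}) := by
    intro i
    by_cases h : ∃ t, l t = i
    · have h2 := hlead h.choose
      rw [h.choose_spec] at h2
      simpa only [e, dif_pos h] using h2
    · simp [e, dif_neg h]
  have heI : ∀ i ∈ I, e i = b i := fun i hi => dif_neg fun ⟨t, ht⟩ => (hI i).1 hi ⟨t, ht⟩
  have hspan : Submodule.span k (Set.range v) = Submodule.span k (e '' Iᶜ) := by
    apply le_antisymm <;> rw [Submodule.span_le]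
    · rintro _ ⟨t, rfl⟩
      generalize hw : l t = w
      induction w using wf.induction generalizing t with
      | _ w ih =>
        have hex : ∃ t, l t = w := ⟨t, hw⟩
        have hewv : e w = v hex.choose := dif_pos hex
        -- Triviality of compositions enters here: any member of the family differs from the chosen
        -- one with the same leading index by members with smaller leading indices.
        have hc := hcomp t hex.choose (hw.trans hex.choose_spec.symm)
        have h : Submodule.span k (v '' {s | r (l s) (l t)}) ≤ Submodule.span k (e '' Iᶜ) := by
          rw [Submodule.span_le]
          rintro _ ⟨s, hs, rfl⟩
          exact ih (l s) (hw ▸ hs) s rfl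
        have hmem : e w ∈ Submodule.span k (e '' Iᶜ) :=
          Submodule.subset_span ⟨w, fun hwI => (hI w).1 hwI hex, rfl⟩
        have := Submodule.add_mem _ (h hc) (hewv ▸ hmem)
        simpa using this
    · rintro _ ⟨i, hi, rfl⟩
      have hex : ∃ t, l t = i := by
        by_contra h
        exact hi ((hI i).2 h)
      have : e i = v hex.choose := dif_pos hex
      rw [this]
      exact Submodule.subset_span ⟨_, rfl⟩
  have hli := linearIndependent_of_leading b r wf tri trans e he
  have hres : LinearIndependent k (fun j : I => e j) := hli.comp _ Subtype.val_injective
  -- The kernel is spanned by the part of `e` outside `I`, so independence of the whole of `e` makes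
  -- it disjoint from the span of the part in `I`.
  have hli' : LinearIndependent k (π ∘ fun j : I => e j) := by
    refine hres.map ?_
    rw [hker, hspan]
    have : Set.range (fun j : I => e j) = e '' I := by
      ext x
      simp
    rw [this]
    exact hli.disjoint_span_image disjoint_compl_right
  refine ⟨Module.Basis.mk hli' ?_, fun j => ?_⟩
  · rw [top_le_iff, Submodule.eq_top_iff']
    intro q
    obtain ⟨p, rfl⟩ := hπ q
    have hp : p ∈ Submodule.span k (Set.range e) := by
      rw [span_eq_top_of_leading b r wf e he]
      trivial
    induction hp using Submodule.span_induction with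
    | zero => simp
    | add x y _ _ hx hy => rw [map_add]; exact Submodule.add_mem _ hx hy
    | smul c x _ hx => rw [map_smul]; exact Submodule.smul_mem _ _ hx
    | mem x hx =>
      obtain ⟨i, rfl⟩ := hx
      by_cases hi : i ∈ I
      · exact Submodule.subset_span ⟨⟨i, hi⟩, rfl⟩
      · have : e i ∈ LinearMap.ker π := by
          rw [hker, hspan]
          exact Submodule.subset_span ⟨i, hi, rfl⟩
        rw [LinearMap.mem_ker.1 this]
        exact Submodule.zero_mem _
  · rw [Module.Basis.mk_apply, Function.comp_apply, heI j j.2]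

/-! ### Leading terms in an algebra with a multiplicative family of monomials -/

/-- A transitive relation that is compatible with multiplication. -/
structure IsMulOrder {M : Type*} [Monoid M] (lt : M → M → Prop) : Prop where
  trans : ∀ u v w, lt u v → lt v w → lt u w
  mul_left : ∀ a u v, lt u v → lt (a * u) (a * v)
  mul_right : ∀ a u v, lt u v → lt (u * a) (v * a)

section Lead

variable {k A M : Type*} [Field k] [Ring A] [Algebra k A] [Monoid M]

/-- The span of the monomials in `P`. -/
def mspan (k : Type*) {A M : Type*} [Field k] [Ring A] [Algebra k A] [Monoid M] (W : M →* A)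
    (P : Set M) : Submodule k A :=
  Submodule.span k (W '' P)

/-- `p` is `c` times the monomial `w` plus a combination of smaller monomials. -/
def HasLead (W : M →* A) (lt : M → M → Prop) (c : k) (w : M) (p : A) : Prop :=
  p - c • W w ∈ mspan k W {v | lt v w}

variable {W : M →* A} {lt : M → M → Prop}

theorem mspan_mono {P Q : Set M} (h : P ⊆ Q) : mspan k W P ≤ mspan k W Q :=
  Submodule.span_mono (Set.image_mono h)

theorem mem_mspan {P : Set M} {w : M} (h : w ∈ P) : W w ∈ mspan k W P :=
  Submodule.subset_span ⟨w, h, rfl⟩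

theorem map_mem_of_mspan {B : Type*} [AddCommGroup B] [Module k B] {P : Set M} {p : A}
    (hp : p ∈ mspan k W P) (F : A →ₗ[k] B) (N : Submodule k B) (h : ∀ w ∈ P, F (W w) ∈ N) :
    F p ∈ N := by
  have : mspan k W P ≤ N.comap F := by
    rw [mspan, Submodule.span_le]
    rintro _ ⟨w, hw, rfl⟩
    exact h w hw
  exact this hp

/-- The middle factor `x` stays fixed so that one lemma serves both plain products (`x = 1`) and
two-sided multiples of a derivative of the relation. -/
theorem mul_mem_of_mspan {P Q : Set M} {p q x : A} (hp : p ∈ mspan k W P)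
    (hq : q ∈ mspan k W Q) (N : Submodule k A)
    (h : ∀ u ∈ P, ∀ v ∈ Q, W u * x * W v ∈ N) : p * x * q ∈ N := by
  refine map_mem_of_mspan hp (LinearMap.mulRight k (x * q)) N (fun u hu => ?_) |>
    fun h => by simpa [mul_assoc] using h
  refine map_mem_of_mspan hq (LinearMap.mulLeft k (W u * x)) N (fun v hv => h u hu v hv) |>
    fun h => by simpa [mul_assoc] using h

theorem mul_mem_mspan {P Q R : Set M} {p q : A} (hp : p ∈ mspan k W P)
    (hq : q ∈ mspan k W Q) (h : ∀ u ∈ P, ∀ v ∈ Q, u * v ∈ R) : p * q ∈ mspan k W R := by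
  have := mul_mem_of_mspan (x := 1) hp hq (mspan k W R) fun u hu v hv => by
    rw [mul_one, ← map_mul]
    exact mem_mspan (h u hu v hv)
  simpa using this

theorem HasLead.mem_mspan {c : k} {w : M} {p : A} (h : HasLead W lt c w p) {P : Set M}
    (hw : w ∈ P) (hP : ∀ v, lt v w → v ∈ P) : p ∈ mspan k W P := by
  have := Submodule.add_mem _ (mspan_mono (fun v hv => hP v hv) h)
    (Submodule.smul_mem _ c (WDiff.mem_mspan (k := k) (W := W) hw))
  simpa using this

theorem HasLead.mem_mspan_le {c : k} {w : M} {p : A} (h : HasLead W lt c w p) :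
    p ∈ mspan k W {v | v = w ∨ lt v w} :=
  h.mem_mspan (Or.inl rfl) fun _ => Or.inr

/-- The coefficient in `HasLead` may vanish, so lower-order terms can be added to a leading term
with `HasLead.add`. -/
theorem hasLead_zero {w : M} {p : A} :
    HasLead W lt (0 : k) w p ↔ p ∈ mspan k W {v | lt v w} := by
  simp [HasLead]

theorem hasLead_self (w : M) : HasLead W lt (1 : k) w (W w) := by
  simp [HasLead]

theorem HasLead.add {c c' : k} {w : M} {p q : A} (hp : HasLead W lt c w p)
    (hq : HasLead W lt c' w q) : HasLead W lt (c + c') w (p + q) := by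
  have := Submodule.add_mem _ hp hq
  rw [HasLead]
  convert this using 1
  rw [add_smul]
  abel

theorem HasLead.smul {c : k} {w : M} {p : A} (hp : HasLead W lt c w p) (a : k) :
    HasLead W lt (a * c) w (a • p) := by
  have := Submodule.smul_mem _ a hp
  rw [HasLead]
  convert this using 1
  rw [smul_sub, mul_smul]

theorem HasLead.of_lt (ho : IsMulOrder lt) {c : k} {v w : M} {p : A} (hp : HasLead W lt c v p)
    (h : lt v w) : HasLead W lt (0 : k) w p :=
  hasLead_zero.2 (hp.mem_mspan h fun u hu => ho.trans u v w hu h)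

theorem HasLead.mul (ho : IsMulOrder lt) {c c' : k} {w w' : M} {p q : A}
    (hp : HasLead W lt c w p) (hq : HasLead W lt c' w' q) :
    HasLead W lt (c * c') (w * w') (p * q) := by
  have h1 : (p - c • W w) * q ∈ mspan k W {v | lt v (w * w')} := by
    refine mul_mem_mspan hp hq.mem_mspan_le ?_
    rintro u hu v (rfl | hv)
    · exact ho.mul_right _ _ _ hu
    · exact ho.trans _ _ _ (ho.mul_right _ _ _ hu) (ho.mul_left _ _ _ hv)
  have h2 : (c • W w) * (q - c' • W w') ∈ mspan k W {v | lt v (w * w')} := by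
    rw [smul_mul_assoc]
    refine Submodule.smul_mem _ _ (mul_mem_mspan (P := {w}) (WDiff.mem_mspan rfl) hq ?_)
    rintro u rfl v hv
    exact ho.mul_left _ _ _ hv
  have := Submodule.add_mem _ h1 h2
  rw [HasLead]
  convert this using 1
  simp only [sub_mul, mul_sub, smul_mul_smul_comm, map_mul]
  abel

/-- A linear map is controlled by its values on monomials: if these have leading monomials moved by
a strictly monotone `sh`, smaller terms stay smaller. It is applied to `1 + lam d`. -/
theorem HasLead.map {σ : A →ₗ[k] A} {sh : M → M} {ε : M → k}
    (hsh : ∀ u v, lt u v → lt (sh u) (sh v)) (ho : IsMulOrder lt)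
    (hσ : ∀ w, HasLead W lt (ε w) (sh w) (σ (W w))) {c : k} {w : M} {p : A}
    (hp : HasLead W lt c w p) : HasLead W lt (c * ε w) (sh w) (σ p) := by
  have h1 : σ (p - c • W w) ∈ mspan k W {v | lt v (sh w)} := by
    refine map_mem_of_mspan hp σ _ fun v hv => ?_
    exact hasLead_zero.1 ((hσ v).of_lt ho (hsh v w hv))
  have h := ((hσ w).smul c).add (hasLead_zero.2 h1)
  simpa using h

theorem HasLead.aeval {x : M} (f : k[X]) (hx : ∀ i < f.natDegree, lt (x ^ i) (x ^ f.natDegree)) :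
    HasLead W lt f.leadingCoeff (x ^ f.natDegree) (aeval (W x) f) := by
  rw [HasLead, aeval_eq_sum_range, Finset.sum_range_succ, map_pow, Polynomial.leadingCoeff,
    add_sub_cancel_right]
  refine Submodule.sum_mem _ fun i hi => Submodule.smul_mem _ _ ?_
  rw [← map_pow]
  exact WDiff.mem_mspan (hx i (Finset.mem_range.1 hi))

/-! ### Combinations of multiples of a family with smaller leading monomials -/

/-- The combinations of the elements `a D_m b` with `a L_m b` smaller than `w`. -/
def smallSpan (k : Type*) {A M : Type*} [Field k] [Ring A] [Algebra k A] [Monoid M] (W : M →* A)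
    (lt : M → M → Prop) (D : ℕ → A) (L : ℕ → M) (w : M) : Submodule k A :=
  Submodule.span k {t | ∃ (m : ℕ) (a b : M), lt (a * L m * b) w ∧ t = W a * D m * W b}

variable {D : ℕ → A} {L : ℕ → M}

theorem mem_smallSpan {w a b : M} {m : ℕ} (h : lt (a * L m * b) w) :
    W a * D m * W b ∈ smallSpan k W lt D L w :=
  Submodule.subset_span ⟨m, a, b, h, rfl⟩

theorem mul_mem_smallSpan {P Q : Set M} {p q : A} {w : M} {m : ℕ} (hp : p ∈ mspan k W P)
    (hq : q ∈ mspan k W Q) (h : ∀ u ∈ P, ∀ v ∈ Q, lt (u * L m * v) w) :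
    p * D m * q ∈ smallSpan k W lt D L w :=
  mul_mem_of_mspan hp hq _ fun u hu v hv => mem_smallSpan (h u hu v hv)

theorem map_mem_of_smallSpan {B : Type*} [AddCommGroup B] [Module k B] {w : M} {p : A}
    (hp : p ∈ smallSpan k W lt D L w) (F : A →ₗ[k] B) (N : Submodule k B)
    (h : ∀ m a b, lt (a * L m * b) w → F (W a * D m * W b) ∈ N) : F p ∈ N := by
  have : smallSpan k W lt D L w ≤ N.comap F := by
    rw [smallSpan, Submodule.span_le]
    rintro _ ⟨m, a, b, hm, rfl⟩
    exact h m a b hm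
  exact this hp

theorem mul_smallSpan_mul (ho : IsMulOrder lt) {w : M} {p : A} (a b : M)
    (hp : p ∈ smallSpan k W lt D L w) : W a * p * W b ∈ smallSpan k W lt D L (a * w * b) := by
  refine map_mem_of_smallSpan hp (LinearMap.mulRight k (W b) ∘ₗ LinearMap.mulLeft k (W a))
    _ fun m u v h => ?_
  have : W a * (W u * D m * W v) * W b = W (a * u) * D m * W (v * b) := by
    simp only [map_mul, mul_assoc]
  simp only [LinearMap.comp_apply, LinearMap.mulLeft_apply, LinearMap.mulRight_apply, this]
  refine mem_smallSpan ?_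
  have := ho.mul_right b _ _ (ho.mul_left a _ _ h)
  simpa only [mul_assoc] using this

variable {c : ℕ → k}

/-- Compositions of two multiples that do not overlap are trivial. -/
theorem disjoint_composition (ho : IsMulOrder lt) (hc : ∀ m, c m ≠ 0)
    (hD : ∀ m, HasLead W lt (c m) (L m) (D m)) (i j : ℕ) (t : M) :
    (c i)⁻¹ • (D i * W (t * L j)) - (c j)⁻¹ • (W (L i * t) * D j) ∈
      smallSpan k W lt D L (L i * t * L j) := by
  have h1 : ∀ m, W (L m) - (c m)⁻¹ • D m ∈ mspan k W {v | lt v (L m)} := by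
    intro m
    have := Submodule.smul_mem _ (-(c m)⁻¹) (hD m)
    rw [smul_sub, smul_smul, neg_mul, inv_mul_cancel₀ (hc m)] at this
    convert this using 1
    simp only [neg_smul, one_smul]
    abel
  -- With `D' = c⁻¹ D` normalised, `D'_i t L_j - L_i t D'_j = D'_i t (L_j - D'_j) - (L_i - D'_i) t
  -- D'_j`. Each bracket contains only monomials below the leading one. `hA` and `hB` treat the two
  -- summands, each up to a scalar.
  have hA : (W (1 : M) * D i * (W t * (W (L j) - (c j)⁻¹ • D j))) ∈
      smallSpan k W lt D L (L i * t * L j) := by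
    refine mul_mem_smallSpan (P := {1}) (mem_mspan rfl)
      (Q := {v | lt (L i * v) (L i * t * L j)}) ?_ ?_
    · refine mul_mem_mspan (P := {t}) (mem_mspan rfl) (h1 j) ?_
      rintro u rfl v hv
      have := ho.mul_left (L i * u) _ _ hv
      simpa only [mul_assoc, Set.mem_ofPred_eq] using this
    · rintro u rfl v hv
      simpa using hv
  have hB : (((W (L i) - (c i)⁻¹ • D i) * W t) * D j * W (1 : M)) ∈
      smallSpan k W lt D L (L i * t * L j) := by
    refine mul_mem_smallSpan (Q := {1}) (P := {v | lt (v * L j) (L i * t * L j)}) ?_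
      (mem_mspan rfl) ?_
    · refine mul_mem_mspan (Q := {t}) (h1 i) (mem_mspan rfl) ?_
      rintro v hv u rfl
      have := ho.mul_right (u * L j) _ _ hv
      simpa only [mul_assoc, Set.mem_ofPred_eq] using this
    · rintro u hu v rfl
      simpa using hu
  have := Submodule.sub_mem _ (Submodule.smul_mem _ (c i)⁻¹ hA)
    (Submodule.smul_mem _ (c j)⁻¹ hB)
  convert this using 1
  simp only [map_one, one_mul, mul_one, map_mul, mul_sub, sub_mul, smul_sub, mul_smul_comm,
    smul_mul_assoc, mul_assoc, smul_smul, mul_comm (c i)⁻¹ (c j)⁻¹]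
  abel

/-- The basis of the quotient by a family all of whose compositions are trivial. -/
theorem exists_basis_of_smallSpan {Q : Type*} [AddCommGroup Q] [Module k Q]
    (ho : IsMulOrder lt) (wf : WellFounded lt) (tri : ∀ i j, lt i j ∨ i = j ∨ lt j i)
    (b : Module.Basis M k A) (hb : ∀ w, b w = W w) (hc : ∀ m, c m ≠ 0)
    (hD : ∀ m, HasLead W lt (c m) (L m) (D m))
    (hcomp : ∀ i j x y x' y', x * L i * y = x' * L j * y' →
      (c i)⁻¹ • (W x * D i * W y) - (c j)⁻¹ • (W x' * D j * W y') ∈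
        smallSpan k W lt D L (x * L i * y))
    (π : A →ₗ[k] Q) (hπ : Function.Surjective π)
    (hker : LinearMap.ker π =
      Submodule.span k (Set.range fun t : M × ℕ × M => W t.1 * D t.2.1 * W t.2.2))
    (I : Set M) (hI : ∀ w, w ∈ I ↔ ¬ ∃ m x y, w = x * L m * y) :
    ∃ B : Module.Basis I k Q, ∀ j, B j = π (W j) := by
  have hbW : (b : M → A) = W := funext hb
  suffices h : ∃ B : Module.Basis I k Q, ∀ j, B j = π (b j) by
    obtain ⟨B, hB⟩ := h
    exact ⟨B, fun j => by rw [hB, hb]⟩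
  refine exists_basis_of_compositions b lt wf tri ho.trans
    (fun t : M × ℕ × M => (c t.2.1)⁻¹ • (W t.1 * D t.2.1 * W t.2.2))
    (fun t => t.1 * L t.2.1 * t.2.2) ?_ ?_ π hπ ?_ I ?_
  · rintro ⟨x, m, y⟩
    have := (((hasLead_self (k := k) (W := W) (lt := lt) x).mul ho (hD m)).mul ho
      (hasLead_self y)).smul (c m)⁻¹
    rw [one_mul, mul_one, inv_mul_cancel₀ (hc m), HasLead, one_smul] at this
    rw [hbW]
    exact this
  · rintro ⟨x, i, y⟩ ⟨x', j, y'⟩ h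
    refine (?_ : smallSpan k W lt D L _ ≤ _) (hcomp i j x y x' y' h)
    rw [smallSpan, Submodule.span_le]
    rintro _ ⟨m, a, b, hm, rfl⟩
    have : W a * D m * W b = c m • ((c m)⁻¹ • (W a * D m * W b)) := by
      rw [smul_smul, mul_inv_cancel₀ (hc m), one_smul]
    rw [this]
    exact Submodule.smul_mem _ _ (Submodule.subset_span ⟨(a, m, b), hm, rfl⟩)
  · rw [hker]
    apply le_antisymm <;> rw [Submodule.span_le]
    · rintro _ ⟨t, rfl⟩
      have : W t.1 * D t.2.1 * W t.2.2 =
          c t.2.1 • ((c t.2.1)⁻¹ • (W t.1 * D t.2.1 * W t.2.2)) := by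
        rw [smul_smul, mul_inv_cancel₀ (hc _), one_smul]
      simp only [SetLike.mem_coe]
      rw [this]
      exact Submodule.smul_mem _ _ (Submodule.subset_span ⟨t, rfl⟩)
    · rintro _ ⟨t, rfl⟩
      exact Submodule.smul_mem _ _ (Submodule.subset_span ⟨t, rfl⟩)
  · intro w
    rw [hI, not_iff_not]
    constructor
    · rintro ⟨m, x, y, rfl⟩
      exact ⟨(x, m, y), rfl⟩
    · rintro ⟨⟨x, m, y⟩, rfl⟩
      exact ⟨m, x, y, rfl⟩

end Lead

/-! ### Derivations of weight `lam` -/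

section Derivation

variable {k : Type*} [Field k] {lam : k}

namespace IsWeightedDerivation

/-- The algebra endomorphism `1 + lam d`. -/
noncomputable def shift {R : Type*} [Ring R] [Algebra k R] {d : R →ₗ[k] R}
    (hd : IsWeightedDerivation lam d) : R →ₐ[k] R :=
  AlgHom.ofLinearMap (LinearMap.id + lam • d) (by simp [hd.map_one]) fun x y => by
    simp only [LinearMap.add_apply, LinearMap.id_apply, LinearMap.smul_apply, hd.leibniz, add_mul,
      mul_add, smul_add, smul_mul_assoc, mul_smul_comm]
    abel

theorem shift_apply {R : Type*} [Ring R] [Algebra k R] {d : R →ₗ[k] R}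
    (hd : IsWeightedDerivation lam d) (x : R) : hd.shift x = x + lam • d x := rfl

/-- A homomorphism that commutes with the derivations on generators commutes with them. -/
theorem comm_of_adjoin {R R' : Type*} [Ring R] [Algebra k R] [Ring R'] [Algebra k R']
    {d : R →ₗ[k] R} {d' : R' →ₗ[k] R'} (hd : IsWeightedDerivation lam d)
    (hd' : IsWeightedDerivation lam d') (ψ : R →ₐ[k] R') {s : Set R}
    (hs : Algebra.adjoin k s = ⊤) (h : ∀ x ∈ s, ψ (d x) = d' (ψ x)) (x : R) :
    ψ (d x) = d' (ψ x) := by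
  have hx : x ∈ Algebra.adjoin k s := hs ▸ Algebra.mem_top
  induction hx using Algebra.adjoin_induction with
  | mem x hx => exact h x hx
  | algebraMap r =>
    rw [Algebra.algebraMap_eq_smul_one]
    simp [hd.map_one, hd'.map_one]
  | add x y _ _ hx hy => simp [hx, hy]
  | mul x y _ _ hx hy => simp [hd.leibniz, hd'.leibniz, hx, hy]

/-- The image of a derivation of weight `lam` under a surjective homomorphism. -/
theorem of_surjective {R R' : Type*} [Ring R] [Algebra k R] [Ring R'] [Algebra k R']
    {d : R →ₗ[k] R} {d' : R' →ₗ[k] R'} (hd : IsWeightedDerivation lam d) (ψ : R →ₐ[k] R')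
    (hψ : Function.Surjective ψ) (h : ∀ x, d' (ψ x) = ψ (d x)) : IsWeightedDerivation lam d' where
  map_one := by rw [← _root_.map_one ψ, h, hd.map_one, map_zero]
  leibniz x y := by
    obtain ⟨x, rfl⟩ := hψ x
    obtain ⟨y, rfl⟩ := hψ y
    simp [← map_mul, h, hd.leibniz]

/-- For nonzero weight, the leading monomials of the iterated derivatives are determined by those
of the images of the monomials under `1 + lam d`. -/
theorem exists_hasLead_iterate {A M : Type*} [Ring A] [Algebra k A] [Monoid M] {W : M →* A}
    {lt : M → M → Prop} {d : A →ₗ[k] A} (hd : IsWeightedDerivation lam d) (hlam : lam ≠ 0)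
    (ho : IsMulOrder lt) {sh : M → M} (hsh : ∀ u v, lt u v → lt (sh u) (sh v)) {ε : M → k}
    (hε : ∀ w, ε w ≠ 0) (hshift : ∀ w, HasLead W lt (ε w) (sh w) (hd.shift (W w)))
    {L : ℕ → M} (hL : ∀ m, sh (L m) = L (m + 1)) (hlt : ∀ m, lt (L m) (L (m + 1))) {G : A}
    (hG : HasLead W lt (1 : k) (L 0) G) (m : ℕ) :
    ∃ c : k, c ≠ 0 ∧ HasLead W lt c (L m) (d^[m] G) := by
  induction m with
  | zero => exact ⟨1, one_ne_zero, hG⟩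
  | succ m ih =>
    obtain ⟨c, hc, h⟩ := ih
    -- Here `d = lam⁻¹ (σ - 1)`. The term from `σ` leads at `L (m + 1)`, while the identity term
    -- leads at the smaller `L m` and so contributes coefficient zero there.
    have h1 := h.map (σ := hd.shift.toLinearMap) hsh ho hshift
    have h2 := (h.of_lt ho (hlt m)).smul (-1)
    rw [hL] at h1
    have h3 := (h1.add h2).smul lam⁻¹
    refine ⟨lam⁻¹ * (c * ε (L m) + -1 * 0), by simp [hlam, hc, hε], ?_⟩
    convert h3 using 1
    rw [Function.iterate_succ_apply', AlgHom.toLinearMap_apply, shift_apply, neg_smul, one_smul,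
      add_neg_cancel_comm, smul_smul, inv_mul_cancel₀ hlam, one_smul]

end IsWeightedDerivation

end Derivation

/-! ### Presentations of free differential algebras -/

section Presentation

/-- `R` need not be commutative: evaluation at a single element is still a homomorphism on `k[X]`,
and it factors through the quotient by `f`. -/
theorem exists_adjoinRoot_algHom {k R : Type*} [Field k] [Ring R] [Algebra k R] {f : k[X]} {r : R}
    (h : aeval r f = 0) : ∃ i : AdjoinRoot f →ₐ[k] R, i (AdjoinRoot.root f) = r := by
  refine ⟨Ideal.Quotient.liftₐ (Ideal.span {f}) (aeval r) fun p hp => ?_, ?_⟩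
  · obtain ⟨q, rfl⟩ := Ideal.mem_span_singleton'.1 hp
    rw [map_mul, h, mul_zero]
  · have : AdjoinRoot.root f = Ideal.Quotient.mk (Ideal.span {f}) X := rfl
    rw [this]
    exact (Ideal.Quotient.lift_mk _ _ _).trans (aeval_X r)

variable {k : Type*} [Field k] {lam : k}

/-- Shared by the commutative and noncommutative presentations. Compatibility with the derivations
needs checking only on the generators `x m`, and it forces the value there by induction on `m`. What
remains to be supplied is an algebra homomorphism with these values. -/
theorem existsUnique_hom_of_generators {F D R : Type*} [Ring F] [Algebra k F] [Ring D]
    [Algebra k D] [Ring R] [Algebra k R] {δ : F →ₗ[k] F} {d : D →ₗ[k] D} {dR : R →ₗ[k] R}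
    (hd : IsWeightedDerivation lam d) (hdR : IsWeightedDerivation lam dR) {x : ℕ → F}
    (hx : Algebra.adjoin k (Set.range x) = ⊤) (hδx : ∀ m, δ (x m) = x (m + 1)) {P : F →ₐ[k] D}
    (hP : Function.Surjective P) (hdP : ∀ p, d (P p) = P (δ p)) {f : k[X]}
    {i : AdjoinRoot f →ₐ[k] D} (hi : i (AdjoinRoot.root f) = P (x 0)) (φ : AdjoinRoot f →ₐ[k] R)
    (hψ : ∃ ψ : D →ₐ[k] R, ∀ m, ψ (P (x m)) = dR^[m] (φ (AdjoinRoot.root f))) :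
    ∃! ψ : D →ₐ[k] R, (∀ y, ψ (d y) = dR (ψ y)) ∧ ψ.comp i = φ := by
  obtain ⟨ψ, hψ⟩ := hψ
  have hadj : Algebra.adjoin k (P '' Set.range x) = ⊤ := by
    rw [← AlgHom.map_adjoin, hx, Algebra.map_top]
    exact (AlgHom.range_eq_top P).2 hP
  refine ⟨ψ, ⟨hd.comm_of_adjoin hdR ψ hadj ?_, AdjoinRoot.algHom_ext ?_⟩, ?_⟩
  · rintro _ ⟨_, ⟨m, rfl⟩, rfl⟩
    rw [hdP, hδx, hψ, hψ, Function.iterate_succ_apply']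
  · rw [AlgHom.comp_apply, hi, hψ, Function.iterate_zero_apply]
  · rintro χ ⟨hχ, hχi⟩
    have hval : ∀ m, χ (P (x m)) = dR^[m] (φ (AdjoinRoot.root f)) := by
      intro m
      induction m with
      | zero => rw [← hi, ← AlgHom.comp_apply, hχi, Function.iterate_zero_apply]
      | succ m ih => rw [← hδx, ← hdP, hχ, ih, Function.iterate_succ_apply']
    refine AlgHom.ext_of_adjoin_eq_top hadj ?_
    rintro _ ⟨_, ⟨m, rfl⟩, rfl⟩
    rw [hval, hψ]

theorem apply_iterate_comm {X Y : Type*} {ψ : X → Y} {d : X → X} {d' : Y → Y}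
    (h : ∀ x, ψ (d x) = d' (ψ x)) (m : ℕ) (x : X) : ψ (d^[m] x) = d'^[m] (ψ x) := by
  induction m with
  | zero => rfl
  | succ m ih => rw [Function.iterate_succ_apply', Function.iterate_succ_apply', h, ih]

/-- `ψ` commutes with the derivations because it does so on generators, so the image is the `m`-th
derivative of `f(r) = 0`. -/
theorem map_iterate_aeval_eq_zero {F R : Type*} [Ring F] [Algebra k F] [Ring R] [Algebra k R]
    {δ : F →ₗ[k] F} {dR : R →ₗ[k] R} (hδ : IsWeightedDerivation lam δ)
    (hdR : IsWeightedDerivation lam dR) {x : ℕ → F}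
    (hx : Algebra.adjoin k (Set.range x) = ⊤) (hδx : ∀ m, δ (x m) = x (m + 1)) {f : k[X]}
    {r : R} (hr : aeval r f = 0) (ψ : F →ₐ[k] R)
    (hψ : ∀ m, ψ (x m) = dR^[m] r) (m : ℕ) : ψ (δ^[m] (aeval (x 0) f)) = 0 := by
  have hcomm := hδ.comm_of_adjoin hdR ψ hx (by
    rintro _ ⟨m, rfl⟩
    rw [hδx, hψ, hψ, Function.iterate_succ_apply'])
  rw [apply_iterate_comm hcomm, ← aeval_algHom_apply, hψ, Function.iterate_zero_apply, hr]
  exact iterate_map_zero dR m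

/-! #### The noncommutative presentation -/

theorem smul_mem_twoSidedIdeal {R : Type*} [Ring R] [Algebra k R] (I : TwoSidedIdeal R) (c : k)
    {x : R} (hx : x ∈ I) : c • x ∈ I := by
  rw [← smul_one_mul]
  exact I.mul_mem_left _ _ hx

/-- Every term of the weighted Leibniz rule for `d(a x)` has `x` or `d x` as a factor, so stability
passes from generators to the ideal. -/
theorem deriv_mem_span {s : Set (FreeAlgebra k ℕ)}
    (hs : ∀ x ∈ s, deriv lam x ∈ TwoSidedIdeal.span s) {x : FreeAlgebra k ℕ}
    (hx : x ∈ TwoSidedIdeal.span s) : deriv lam x ∈ TwoSidedIdeal.span s := by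
  induction hx using TwoSidedIdeal.span_induction with
  | mem x hx => exact hs x hx
  | zero => rw [map_zero]; exact TwoSidedIdeal.zero_mem _
  | add x y _ _ hx hy => rw [map_add]; exact TwoSidedIdeal.add_mem _ hx hy
  | neg x _ hx => rw [map_neg]; exact TwoSidedIdeal.neg_mem _ hx
  | left_absorb a x hx hdx =>
    rw [(isWeightedDerivation_deriv lam).leibniz]
    exact TwoSidedIdeal.add_mem _ (TwoSidedIdeal.add_mem _ (TwoSidedIdeal.mul_mem_left _ _ _ hx)
      (TwoSidedIdeal.mul_mem_left _ _ _ hdx))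
      (smul_mem_twoSidedIdeal _ _ (TwoSidedIdeal.mul_mem_left _ _ _ hdx))
  | right_absorb a x hx hdx =>
    rw [(isWeightedDerivation_deriv lam).leibniz]
    exact TwoSidedIdeal.add_mem _ (TwoSidedIdeal.add_mem _ (TwoSidedIdeal.mul_mem_right _ _ _ hdx)
      (TwoSidedIdeal.mul_mem_right _ _ _ hx))
      (smul_mem_twoSidedIdeal _ _ (TwoSidedIdeal.mul_mem_right _ _ _ hdx))

theorem deriv_mem_relIdeal (f : k[X]) {x : FreeAlgebra k ℕ} (hx : x ∈ relIdeal lam f) :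
    deriv lam x ∈ relIdeal lam f := by
  refine deriv_mem_span ?_ hx
  rintro _ ⟨m, rfl⟩
  exact TwoSidedIdeal.subset_span ⟨m + 1, Function.iterate_succ_apply' _ _ _⟩

theorem relIdeal_eq_diffIdeal (f : k[X]) : relIdeal lam f = diffIdeal lam {rel f} := by
  apply le_antisymm
  · rw [diffIdeal]
    refine le_sInf ?_
    rintro I ⟨hI, hd⟩
    rw [relIdeal, TwoSidedIdeal.span_le]
    rintro _ ⟨m, rfl⟩
    induction m with
    | zero => exact hI _ rfl
    | succ m ih =>
      simp only [Function.iterate_succ_apply']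
      exact hd _ ih
  · refine sInf_le ⟨?_, fun x hx => deriv_mem_relIdeal f hx⟩
    rintro _ rfl
    exact TwoSidedIdeal.subset_span ⟨0, rfl⟩

/-- Justifies replacing the relation by its monic multiple. -/
theorem diffIdeal_smul {c : k} (hc : c ≠ 0) (p : FreeAlgebra k ℕ) :
    diffIdeal lam {c • p} = diffIdeal lam {p} := by
  have : ∀ I : TwoSidedIdeal (FreeAlgebra k ℕ), c • p ∈ I ↔ p ∈ I := fun I => by
    refine ⟨fun h => ?_, smul_mem_twoSidedIdeal I c⟩
    have := smul_mem_twoSidedIdeal I c⁻¹ h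
    rwa [smul_smul, inv_mul_cancel₀ hc, one_smul] at this
  simp only [diffIdeal, Set.mem_singleton_iff, forall_eq, this]

theorem proj_surjective (f : k[X]) : Function.Surjective (proj lam f) :=
  RingCon.mkₐ_surjective _

theorem proj_eq_zero (f : k[X]) {p : FreeAlgebra k ℕ} : proj lam f p = 0 ↔ p ∈ relIdeal lam f := by
  rw [TwoSidedIdeal.mem_iff, ← RingCon.eq]
  rfl

theorem exists_presentation (lam : k) (f : k[X]) :
    ∃ (d : RelQuotient lam f →ₗ[k] RelQuotient lam f)
      (i : AdjoinRoot f →ₐ[k] RelQuotient lam f),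
      (∀ p, d (proj lam f p) = proj lam f (deriv lam p)) ∧
      i (AdjoinRoot.root f) = proj lam f (FreeAlgebra.ι k 0) ∧
      IsFreeDiffAlgebra.{v} lam d i := by
  have hker : LinearMap.ker (proj lam f).toLinearMap ≤
      LinearMap.ker ((proj lam f).toLinearMap ∘ₗ deriv lam) := by
    intro x hx
    exact (proj_eq_zero f).2 (deriv_mem_relIdeal f ((proj_eq_zero f).1 hx))
  let e := (proj lam f).toLinearMap.quotKerEquivOfSurjective (proj_surjective f)
  let d : RelQuotient lam f →ₗ[k] RelQuotient lam f :=
    (LinearMap.ker (proj lam f).toLinearMap).liftQ _ hker ∘ₗ e.symm.toLinearMap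
  have hd : ∀ p, d (proj lam f p) = proj lam f (deriv lam p) := by
    intro p
    have : e.symm (proj lam f p) = Submodule.Quotient.mk p := by
      rw [LinearEquiv.symm_apply_eq]
      rfl
    simp [d, this]
  have hroot : aeval (proj lam f (FreeAlgebra.ι k 0)) f = 0 := by
    rw [aeval_algHom_apply]
    exact (proj_eq_zero f).2 (TwoSidedIdeal.subset_span ⟨0, rfl⟩)
  obtain ⟨i, hi⟩ := exists_adjoinRoot_algHom hroot
  have hdD : IsWeightedDerivation lam d :=
    (isWeightedDerivation_deriv lam).of_surjective _ (proj_surjective f) hd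
  refine ⟨d, i, hd, hi, hdD, fun R _ _ dR hdR φ => ?_⟩
  refine existsUnique_hom_of_generators hdD hdR (FreeAlgebra.adjoin_range_ι k ℕ) (deriv_ι lam)
    (proj_surjective f) hd hi φ ?_
  let ψ : FreeAlgebra k ℕ →ₐ[k] R :=
    FreeAlgebra.lift k fun m => dR^[m] (φ (AdjoinRoot.root f))
  have hψ : ∀ m, ψ (FreeAlgebra.ι k m) = dR^[m] (φ (AdjoinRoot.root f)) :=
    fun m => FreeAlgebra.lift_ι_apply _ _
  have hφ : aeval (φ (AdjoinRoot.root f)) f = 0 := by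
    rw [aeval_algHom_apply, AdjoinRoot.aeval_eq, AdjoinRoot.mk_self, map_zero]
  have hle : relIdeal lam f ≤ TwoSidedIdeal.ker ψ := by
    rw [relIdeal, TwoSidedIdeal.span_le]
    rintro _ ⟨m, rfl⟩
    exact (TwoSidedIdeal.mem_ker ψ).2 (map_iterate_aeval_eq_zero (isWeightedDerivation_deriv lam)
      hdR (FreeAlgebra.adjoin_range_ι k ℕ) (deriv_ι lam) hφ ψ hψ m)
  refine ⟨RingCon.liftₐ _ ψ fun x y h => ?_, fun m => hψ m⟩
  have := hle (((relIdeal lam f).rel_iff x y).1 h)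
  rw [TwoSidedIdeal.mem_ker, map_sub, sub_eq_zero] at this
  exact this

/-! #### The commutative presentation -/

theorem cDeriv_mem_cRelIdeal (f : k[X]) {x : MvPolynomial ℕ k} (hx : x ∈ cRelIdeal lam f) :
    cDeriv lam x ∈ cRelIdeal lam f := by
  induction hx using Submodule.span_induction with
  | mem x h =>
    obtain ⟨m, rfl⟩ := h
    exact Ideal.subset_span ⟨m + 1, Function.iterate_succ_apply' _ _ _⟩
  | zero => rw [map_zero]; exact Ideal.zero_mem _
  | add x y hx hy h h' => rw [map_add]; exact Ideal.add_mem _ h h'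
  | smul a x hx h =>
    rw [smul_eq_mul, (isWeightedDerivation_cDeriv lam).leibniz, MvPolynomial.smul_eq_C_mul]
    exact Ideal.add_mem _ (Ideal.add_mem _ (Ideal.mul_mem_left _ _ hx)
      (Ideal.mul_mem_left _ _ h))
      (Ideal.mul_mem_left _ _ (Ideal.mul_mem_left _ _ h))

theorem cRelIdeal_eq_cDiffIdeal (f : k[X]) : cRelIdeal lam f = cDiffIdeal lam {cRel f} := by
  apply le_antisymm
  · rw [cDiffIdeal]
    refine le_sInf ?_
    rintro I ⟨hI, hd⟩
    rw [cRelIdeal, Ideal.span_le]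
    rintro _ ⟨m, rfl⟩
    induction m with
    | zero => exact hI _ rfl
    | succ m ih =>
      simp only [Function.iterate_succ_apply']
      exact hd _ ih
  · refine sInf_le ⟨?_, fun x hx => cDeriv_mem_cRelIdeal f hx⟩
    rintro _ rfl
    exact Ideal.subset_span ⟨0, rfl⟩

theorem cDiffIdeal_smul {c : k} (hc : c ≠ 0) (p : MvPolynomial ℕ k) :
    cDiffIdeal lam {c • p} = cDiffIdeal lam {p} := by
  have : ∀ I : Ideal (MvPolynomial ℕ k), c • p ∈ I ↔ p ∈ I := fun I => by
    rw [MvPolynomial.smul_eq_C_mul]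
    refine ⟨fun h => ?_, I.mul_mem_left _⟩
    have := I.mul_mem_left (MvPolynomial.C c⁻¹) h
    rwa [← mul_assoc, ← map_mul, inv_mul_cancel₀ hc, map_one, one_mul] at this
  simp only [cDiffIdeal, Set.mem_singleton_iff, forall_eq, this]

theorem cProj_surjective (f : k[X]) : Function.Surjective (cProj lam f) :=
  Ideal.Quotient.mkₐ_surjective _ _

theorem cProj_eq_zero (f : k[X]) {p : MvPolynomial ℕ k} :
    cProj lam f p = 0 ↔ p ∈ cRelIdeal lam f :=
  Ideal.Quotient.eq_zero_iff_mem

theorem exists_cPresentation (lam : k) (f : k[X]) :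
    ∃ (d : CRelQuotient lam f →ₗ[k] CRelQuotient lam f)
      (i : AdjoinRoot f →ₐ[k] CRelQuotient lam f),
      (∀ p, d (cProj lam f p) = cProj lam f (cDeriv lam p)) ∧
      i (AdjoinRoot.root f) = cProj lam f (MvPolynomial.X 0) ∧
      IsFreeCommDiffAlgebra.{v} lam d i := by
  have hker : LinearMap.ker (cProj lam f).toLinearMap ≤
      LinearMap.ker ((cProj lam f).toLinearMap ∘ₗ cDeriv lam) := by
    intro x hx
    exact (cProj_eq_zero f).2 (cDeriv_mem_cRelIdeal f ((cProj_eq_zero f).1 hx))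
  let e := (cProj lam f).toLinearMap.quotKerEquivOfSurjective (cProj_surjective f)
  let d : CRelQuotient lam f →ₗ[k] CRelQuotient lam f :=
    (LinearMap.ker (cProj lam f).toLinearMap).liftQ _ hker ∘ₗ e.symm.toLinearMap
  have hd : ∀ p, d (cProj lam f p) = cProj lam f (cDeriv lam p) := by
    intro p
    have : e.symm (cProj lam f p) = Submodule.Quotient.mk p := by
      rw [LinearEquiv.symm_apply_eq]
      rfl
    simp [d, this]
  have hroot : aeval (cProj lam f (MvPolynomial.X 0)) f = 0 := by
    rw [aeval_algHom_apply]
    exact (cProj_eq_zero f).2 (Ideal.subset_span ⟨0, rfl⟩)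
  obtain ⟨i, hi⟩ := exists_adjoinRoot_algHom hroot
  have hdD : IsWeightedDerivation lam d :=
    (isWeightedDerivation_cDeriv lam).of_surjective _ (cProj_surjective f) hd
  refine ⟨d, i, hd, hi, hdD, fun R _ _ dR hdR φ => ?_⟩
  refine existsUnique_hom_of_generators hdD hdR MvPolynomial.adjoin_range_X (cDeriv_X lam)
    (cProj_surjective f) hd hi φ ?_
  let ψ : MvPolynomial ℕ k →ₐ[k] R :=
    MvPolynomial.aeval fun m => dR^[m] (φ (AdjoinRoot.root f))
  have hψ : ∀ m, ψ (MvPolynomial.X m) = dR^[m] (φ (AdjoinRoot.root f)) :=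
    fun m => MvPolynomial.aeval_X _ _
  have hφ : aeval (φ (AdjoinRoot.root f)) f = 0 := by
    rw [aeval_algHom_apply, AdjoinRoot.aeval_eq, AdjoinRoot.mk_self, map_zero]
  have hle : cRelIdeal lam f ≤ RingHom.ker ψ := by
    rw [cRelIdeal, Ideal.span_le]
    rintro _ ⟨m, rfl⟩
    exact (RingHom.mem_ker).2 (map_iterate_aeval_eq_zero (isWeightedDerivation_cDeriv lam)
      hdR MvPolynomial.adjoin_range_X (cDeriv_X lam) hφ ψ hψ m)
  refine ⟨Ideal.Quotient.liftₐ _ ψ fun x h => hle h, fun m => ?_⟩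
  exact (Ideal.Quotient.lift_mk _ _ _).trans (hψ m)

end Presentation

/-! ### Weak and strict inequalities in a multiplicative order -/

theorem IsMulOrder.mul_le {M : Type*} [Monoid M] {lt : M → M → Prop} (ho : IsMulOrder lt)
    {u u' v v' : M} (hu : u = u' ∨ lt u u') (hv : v = v' ∨ lt v v') :
    u * v = u' * v' ∨ lt (u * v) (u' * v') := by
  rcases hu with rfl | hu <;> rcases hv with rfl | hv
  · exact Or.inl rfl
  · exact Or.inr (ho.mul_left _ _ _ hv)
  · exact Or.inr (ho.mul_right _ _ _ hu)
  · exact Or.inr (ho.trans _ _ _ (ho.mul_right _ _ _ hu) (ho.mul_left _ _ _ hv))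

theorem IsMulOrder.lt_of_le_of_lt {M : Type*} [Monoid M] {lt : M → M → Prop} (ho : IsMulOrder lt)
    {u v w : M} (hu : u = v ∨ lt u v) (h : lt v w) : lt u w := by
  rcases hu with rfl | hu
  · exact h
  · exact ho.trans _ _ _ hu h

/-- Monomials in a product with the middle factor strictly smaller. -/
theorem IsMulOrder.mul_lt_mul {M : Type*} [Monoid M] {lt : M → M → Prop} (ho : IsMulOrder lt)
    {u u' x x' v v' : M} (hu : u = u' ∨ lt u u') (hx : lt x x') (hv : v = v' ∨ lt v v') :
    lt (u * x * v) (u' * x' * v') := by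
  refine ho.lt_of_le_of_lt (ho.mul_le (ho.mul_le hu (Or.inl rfl)) hv) ?_
  exact ho.mul_right _ _ _ (ho.mul_left _ _ _ hx)

/-! ### The order on words -/

section Words

theorem lex_append_right {α : Type*} {r : α → α → Prop} {s t : List α} (h : List.Lex r s t)
    (hl : s.length = t.length) (a : List α) : List.Lex r (s ++ a) (t ++ a) := by
  induction h with
  | nil => simp at hl
  | cons _ ih => exact List.Lex.cons (ih (by simpa using hl))
  | rel h => exact List.Lex.rel h

theorem lex_map {α β : Type*} {r : α → α → Prop} {r' : β → β → Prop} {g : α → β}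
    (hg : ∀ a b, r a b → r' (g a) (g b)) {s t : List α} (h : List.Lex r s t) :
    List.Lex r' (s.map g) (t.map g) := by
  induction h with
  | nil => exact List.Lex.nil
  | cons _ ih => exact List.Lex.cons ih
  | rel h => exact List.Lex.rel (hg _ _ h)

theorem wordLT_wf : WellFounded WordLT :=
  InvImage.wf FreeMonoid.toList (List.Shortlex.wf Nat.lt_wfRel.wf)

theorem wordLT_irrefl (w : FreeMonoid ℕ) : ¬ WordLT w w :=
  fun h => wordLT_wf.asymmetric _ _ h h

theorem wordLT_tri (a b : FreeMonoid ℕ) : WordLT a b ∨ a = b ∨ WordLT b a := by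
  by_contra! hc
  exact hc.2.1 (Std.Trichotomous.trichotomous (r := List.Shortlex (· < ·)) a b hc.1 hc.2.2)

theorem isMulOrder_wordLT : IsMulOrder WordLT where
  trans x y z hxy hyz := by
    rcases List.shortlex_def.1 hxy with h1 | h1 <;> rcases List.shortlex_def.1 hyz with h2 | h2
    · exact List.shortlex_def.2 (Or.inl (h1.trans h2))
    · exact List.shortlex_def.2 (Or.inl (h2.1 ▸ h1))
    · exact List.shortlex_def.2 (Or.inl (h1.1 ▸ h2))
    · exact List.shortlex_def.2 (Or.inr ⟨h1.1.trans h2.1,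
        (List.lt_trans (h1.2 : x.toList < y.toList) (h2.2 : y.toList < z.toList) :
          x.toList < z.toList)⟩)
  mul_left a u v h := List.Shortlex.append_left h _
  mul_right a u v h := by
    rcases List.shortlex_def.1 h with h | h
    · refine List.Shortlex.of_length_lt ?_
      rw [FreeMonoid.toList_mul, FreeMonoid.toList_mul, List.length_append, List.length_append]
      omega
    · refine List.Shortlex.of_lex ?_ (lex_append_right h.2 h.1 _)
      rw [FreeMonoid.toList_mul, FreeMonoid.toList_mul, List.length_append, List.length_append,
        h.1]

theorem wordLT_of_length_lt {u v : FreeMonoid ℕ} (h : u.length < v.length) : WordLT u v :=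
  List.Shortlex.of_length_lt h

theorem wordLT_map_succ {u v : FreeMonoid ℕ} (h : WordLT u v) :
    WordLT (FreeMonoid.map Nat.succ u) (FreeMonoid.map Nat.succ v) := by
  have hm : ∀ w : FreeMonoid ℕ, (FreeMonoid.map Nat.succ w).toList = w.toList.map Nat.succ :=
    fun _ => rfl
  rw [WordLT, hm, hm]
  rcases List.shortlex_def.1 h with h | h
  · exact List.Shortlex.of_length_lt (by simpa using h)
  · exact List.Shortlex.of_lex (by simpa using h.1)
      (lex_map (g := Nat.succ) (fun a b h => Nat.succ_lt_succ h) h.2)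

theorem length_of_pow (m n : ℕ) : (FreeMonoid.of m ^ n).length = n := by
  induction n with
  | zero => rfl
  | succ n ih => rw [pow_succ, FreeMonoid.length_mul, ih, FreeMonoid.length_of]

theorem toList_of_pow (m n : ℕ) : (FreeMonoid.of m ^ n).toList = List.replicate n m := by
  induction n with
  | zero => rfl
  | succ n ih =>
    rw [pow_succ', FreeMonoid.toList_mul, ih, FreeMonoid.toList_of, List.replicate_succ]
    rfl

theorem wordLT_of_mul {i j : ℕ} {u v : FreeMonoid ℕ} (h : i < j) (hl : u.length = v.length) :
    WordLT (FreeMonoid.of i * u) (FreeMonoid.of j * v) :=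
  List.Shortlex.of_lex (congrArg Nat.succ hl) (List.Lex.rel h)

theorem wordLT_pow {i j n : ℕ} (hn : 0 < n) (h : i < j) :
    WordLT (FreeMonoid.of i ^ n) (FreeMonoid.of j ^ n) := by
  obtain ⟨n, rfl⟩ := Nat.exists_eq_succ_of_ne_zero hn.ne'
  rw [Nat.succ_eq_add_one, pow_succ', pow_succ']
  exact wordLT_of_mul h (by rw [length_of_pow, length_of_pow])

/-- The first letter of a word. -/
def firstLetter (w : FreeMonoid ℕ) : ℕ :=
  w.toList.headD 0

theorem firstLetter_mul (a : FreeMonoid ℕ) (m : ℕ) (z : FreeMonoid ℕ) :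
    firstLetter (a * (FreeMonoid.of m * z)) = if a.length = 0 then m else firstLetter a := by
  cases a using FreeMonoid.casesOn with
  | one => rfl
  | of_mul x xs => rfl

theorem lex_replicate_zero {s : List ℕ} {N : ℕ} (hl : s.length = N) :
    ¬ List.Lex (· < ·) s (List.replicate N 0) := by
  induction N generalizing s with
  | zero => intro h; cases h
  | succ N ih =>
    intro h
    rw [List.replicate_succ] at h
    cases h with
    | nil => simp at hl
    | cons h => exact ih (by simpa using hl) h
    | rel h => exact absurd h (Nat.not_lt_zero _)

/-- A tail of letters `x^(0)` is lexicographically minimal among words of its length, so only the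
total length and the first letter decide the comparison. This reduces the order estimates in weight
zero to arithmetic. -/
theorem wordLT_of_mul_zero_pow {v : FreeMonoid ℕ} {i N : ℕ} :
    WordLT v (FreeMonoid.of i * FreeMonoid.of 0 ^ N) ↔
      v.length < N + 1 ∨ (v.length = N + 1 ∧ firstLetter v < i) := by
  have hL : (FreeMonoid.of i * FreeMonoid.of 0 ^ N).toList = i :: List.replicate N 0 := by
    rw [FreeMonoid.toList_mul, toList_of_pow]
    rfl
  rw [WordLT, hL, List.shortlex_def, List.length_cons, List.length_replicate]
  refine or_congr Iff.rfl (and_congr_right fun hl => ?_)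
  cases v using FreeMonoid.casesOn with
  | one => simp at hl
  | of_mul x xs =>
    have hl' : xs.toList.length = N := Nat.succ.inj hl
    change List.Lex _ (x :: xs.toList) _ ↔ x < i
    constructor
    · intro h
      cases h with
      | cons h => exact absurd h (lex_replicate_zero hl')
      | rel h => exact h
    · exact List.Lex.rel

/-! ### Leading words in the free algebra -/

variable {k : Type*} [Field k]

/-- Words in the free algebra as a homomorphism of monoids. -/
noncomputable def wordHom (k : Type*) [Field k] : FreeMonoid ℕ →* FreeAlgebra k ℕ :=
  FreeMonoid.lift (FreeAlgebra.ι k)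

theorem wordHom_apply (w : FreeMonoid ℕ) : wordHom k w = word w := rfl

theorem wordHom_of (m : ℕ) : wordHom k (FreeMonoid.of m) = FreeAlgebra.ι k m := by
  simp [wordHom]

/-- Bridge from the span formulation of leading terms, which suits algebraic manipulation, to the
coefficient formulation used in the definitions. -/
theorem isLeadWord_of_hasLead {c : k} (hc : c ≠ 0) {w : FreeMonoid ℕ} {p : FreeAlgebra k ℕ}
    (h : HasLead (wordHom k) WordLT c w p) : IsLeadWord p w ∧ coeff p w = c := by
  have hW : (wordHom k : FreeMonoid ℕ → FreeAlgebra k ℕ) = FreeAlgebra.basisFreeMonoid k ℕ :=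
    funext fun v => (basis_apply v).symm
  rw [HasLead, mspan, hW] at h
  have hsupp := (Module.Basis.mem_span_image _).1 h
  have hcoeff : ∀ v, ¬ WordLT v w → coeff p v = Finsupp.single w c v := by
    intro v hv
    by_contra hne
    refine hv (hsupp (Finsupp.mem_support_iff.2 ?_))
    rw [map_sub, map_smul, Module.Basis.repr_self, Finsupp.sub_apply, Finsupp.smul_single,
      smul_eq_mul, mul_one]
    exact sub_ne_zero.2 hne
  have hw : coeff p w = c := by rw [hcoeff w (wordLT_irrefl w), Finsupp.single_eq_same]
  refine ⟨⟨hw ▸ hc, fun v hv => ?_⟩, hw⟩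
  by_contra! hne
  rw [hcoeff v hne.2, Finsupp.single_eq_of_ne hne.1] at hv
  exact hv rfl

theorem ne_zero_of_hasLead {c : k} (hc : c ≠ 0) {w : FreeMonoid ℕ} {p : FreeAlgebra k ℕ}
    (h : HasLead (wordHom k) WordLT c w p) : p ≠ 0 := by
  rintro rfl
  exact (isLeadWord_of_hasLead hc h).1.1 (by simp [coeff])

theorem leadWord_of_hasLead {c : k} (hc : c ≠ 0) {w : FreeMonoid ℕ} {p : FreeAlgebra k ℕ}
    (h : HasLead (wordHom k) WordLT c w p) : leadWord p = w :=
  (isLeadWord_leadWord (ne_zero_of_hasLead hc h)).unique (isLeadWord_of_hasLead hc h).1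

theorem leadCoeff_of_hasLead {c : k} (hc : c ≠ 0) {w : FreeMonoid ℕ} {p : FreeAlgebra k ℕ}
    (h : HasLead (wordHom k) WordLT c w p) : leadCoeff p = c := by
  rw [leadCoeff, leadWord_of_hasLead hc h, (isLeadWord_of_hasLead hc h).2]

end Words

/-! ### Leading words and overlaps of the derivatives of a polynomial in `x^(0)` -/

section Overlap

variable {k : Type*} [Field k] {lam : k} {n : ℕ} {G : FreeAlgebra k ℕ}

/-! #### Nonzero weight -/

/-- By multiplicativity of `1 + lam d` it is enough to look at a letter, whose image is `x^(m) + lam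
x^(m+1)`. -/
theorem hasLead_shift_word (lam : k) (w : FreeMonoid ℕ) :
    HasLead (wordHom k) WordLT (lam ^ w.length) (FreeMonoid.map Nat.succ w)
      ((isWeightedDerivation_deriv lam).shift (wordHom k w)) := by
  induction w using FreeMonoid.inductionOn' with
  | one => simpa using hasLead_self (W := wordHom k) (lt := WordLT) 1
  | of_mul m w ih =>
    have h : HasLead (wordHom k) WordLT lam (FreeMonoid.of (m + 1))
        ((isWeightedDerivation_deriv lam).shift (wordHom k (FreeMonoid.of m))) := by
      rw [IsWeightedDerivation.shift_apply, wordHom_of, deriv_ι, ← wordHom_of, ← wordHom_of]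
      have h1 := (hasLead_self (k := k) (W := wordHom k) (lt := WordLT)
        (FreeMonoid.of m)).of_lt isMulOrder_wordLT
        (show WordLT (FreeMonoid.of m) (FreeMonoid.of (m + 1)) from
          List.Shortlex.of_lex rfl (List.Lex.rel (Nat.lt_succ_self m)))
      have h2 := (hasLead_self (k := k) (W := wordHom k) (lt := WordLT)
        (FreeMonoid.of (m + 1))).smul lam
      simpa using h1.add h2
    have := h.mul isMulOrder_wordLT ih
    rw [map_mul, map_mul, map_mul, FreeMonoid.length_mul, pow_add, FreeMonoid.length_of, pow_one]
    exact this

theorem exists_hasLead_iterate (hlam : lam ≠ 0) (hn : 0 < n)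
    (hG : HasLead (wordHom k) WordLT (1 : k) (FreeMonoid.of 0 ^ n) G) (m : ℕ) :
    ∃ c : k, c ≠ 0 ∧ HasLead (wordHom k) WordLT c (FreeMonoid.of m ^ n) ((deriv lam)^[m] G) := by
  refine (isWeightedDerivation_deriv lam).exists_hasLead_iterate hlam isMulOrder_wordLT
    (L := fun m => FreeMonoid.of m ^ n) (fun _ _ => wordLT_map_succ)
    (fun w => pow_ne_zero w.length hlam) (hasLead_shift_word lam) (fun m => ?_)
    (fun m => wordLT_pow hn (Nat.lt_succ_self m)) hG m
  rw [map_pow, FreeMonoid.map_of]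

/-- `σ(a D_m b) = σ(a) D_m σ(b) + lam σ(a) D_{m+1} σ(b)`. The second term leads at most at the shift
of `a L_m b`, and the first lies strictly below that because `L_m < L_{m+1}`. -/
theorem shift_mem_smallSpan (hn : 0 < n) {w : FreeMonoid ℕ} {p : FreeAlgebra k ℕ}
    (hp : p ∈ smallSpan k (wordHom k) WordLT (fun m => (deriv lam)^[m] G)
      (fun m => FreeMonoid.of m ^ n) w) :
    (isWeightedDerivation_deriv lam).shift p ∈
      smallSpan k (wordHom k) WordLT (fun m => (deriv lam)^[m] G)
        (fun m => FreeMonoid.of m ^ n) (FreeMonoid.map Nat.succ w) := by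
  refine map_mem_of_smallSpan hp (isWeightedDerivation_deriv lam).shift.toLinearMap _
    fun m a b h => ?_
  have hab := wordLT_map_succ h
  rw [map_mul, map_mul, map_pow, FreeMonoid.map_of] at hab
  rw [AlgHom.toLinearMap_apply, map_mul, map_mul, IsWeightedDerivation.shift_apply _ (_^[m] _),
    ← Function.iterate_succ_apply' (deriv lam), mul_add, add_mul, mul_smul_comm, smul_mul_assoc]
  have ho := isMulOrder_wordLT
  refine Submodule.add_mem _ ?_ (Submodule.smul_mem _ _ ?_)
  · exact mul_mem_smallSpan (D := fun m => (deriv lam)^[m] G) (hasLead_shift_word lam a).mem_mspan_le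
      (hasLead_shift_word lam b).mem_mspan_le fun u hu v hv =>
        ho.trans _ _ _ (ho.mul_lt_mul hu (wordLT_pow hn (Nat.lt_succ_self m)) hv) hab
  · exact mul_mem_smallSpan (D := fun m => (deriv lam)^[m] G) (hasLead_shift_word lam a).mem_mspan_le
      (hasLead_shift_word lam b).mem_mspan_le fun u hu v hv =>
        ho.lt_of_le_of_lt (ho.mul_le (ho.mul_le hu (Or.inl rfl)) hv) hab

/-- Induction on `i`, starting from the vanishing commutator of `G` with `x^(0)`. With `q =
σ((x^(i))^r)`, applying `σ` to the `i`-th commutator gives `[D_i, q] + lam [D_{i+1}, q]`. Here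
`[D_i, q]` is small, and `q` is `lam^r (x^(i+1))^r` up to smaller words, so `lam^(r+1)` times the
next commutator is small. -/
theorem overlap_mem_smallSpan (hlam : lam ≠ 0) (hn : 0 < n)
    (hcomm : Commute G (FreeAlgebra.ι k 0)) (r i : ℕ) :
    (deriv lam)^[i] G * wordHom k (FreeMonoid.of i ^ r) -
        wordHom k (FreeMonoid.of i ^ r) * (deriv lam)^[i] G ∈
      smallSpan k (wordHom k) WordLT (fun m => (deriv lam)^[m] G)
        (fun m => FreeMonoid.of m ^ n) (FreeMonoid.of i ^ (n + r)) := by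
  have ho := isMulOrder_wordLT
  induction i with
  | zero =>
    rw [map_pow, wordHom_of, Function.iterate_zero_apply, (hcomm.pow_right r).eq, sub_self]
    exact Submodule.zero_mem _
  | succ i ih =>
    have hσ := shift_mem_smallSpan hn ih
    rw [map_pow, FreeMonoid.map_of, Nat.succ_eq_add_one] at hσ
    set σ := (isWeightedDerivation_deriv lam).shift with hσdef
    set N := smallSpan k (wordHom k) WordLT (fun m => (deriv lam)^[m] G)
        (fun m => FreeMonoid.of m ^ n) (FreeMonoid.of (i + 1) ^ (n + r)) with hN
    set x := FreeMonoid.of (i + 1) with hx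
    set q := σ (wordHom k (FreeMonoid.of i ^ r)) with hq
    have hqL : HasLead (wordHom k) WordLT (lam ^ r) (x ^ r) q := by
      have := hasLead_shift_word lam (FreeMonoid.of i ^ r)
      rwa [length_of_pow, map_pow, FreeMonoid.map_of] at this
    -- `h1` and `h2` discard the two halves of `[D_i, q]`; `h3` and `h4` replace `q` by its leading
    -- term next to `D_{i+1}`.
    have h1 : wordHom k 1 * (deriv lam)^[i] G * q ∈ N := by
      refine mul_mem_smallSpan (D := fun m => (deriv lam)^[m] G) (mem_mspan (P := {1}) rfl)
        hqL.mem_mspan_le ?_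
      rintro u hu v hv
      have := ho.mul_lt_mul (Or.inl hu) (wordLT_pow hn (Nat.lt_succ_self i)) hv
      rwa [one_mul, Nat.succ_eq_add_one, ← hx, ← pow_add] at this
    have h2 : q * (deriv lam)^[i] G * wordHom k 1 ∈ N := by
      refine mul_mem_smallSpan (D := fun m => (deriv lam)^[m] G) hqL.mem_mspan_le
        (mem_mspan (P := {1}) rfl) ?_
      rintro u hu v hv
      have := ho.mul_lt_mul hu (wordLT_pow hn (Nat.lt_succ_self i)) (Or.inl hv)
      rwa [mul_one, Nat.succ_eq_add_one, ← hx, ← pow_add, add_comm r n] at this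
    have h3 : wordHom k 1 * (deriv lam)^[i + 1] G * (q - lam ^ r • wordHom k (x ^ r)) ∈ N := by
      refine mul_mem_smallSpan (D := fun m => (deriv lam)^[m] G) (mem_mspan (P := {1}) rfl)
        hqL ?_
      rintro u rfl v hv
      have := ho.mul_left (x ^ n) _ _ hv
      rwa [← pow_add, ← one_mul (x ^ n)] at this
    have h4 : (q - lam ^ r • wordHom k (x ^ r)) * (deriv lam)^[i + 1] G * wordHom k 1 ∈ N := by
      refine mul_mem_smallSpan (D := fun m => (deriv lam)^[m] G) hqL
        (mem_mspan (P := {1}) rfl) ?_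
      rintro u hu v rfl
      have := ho.mul_right (x ^ n) _ _ hu
      rwa [← pow_add, add_comm r n, ← mul_one (u * x ^ n)] at this
    have h5 := N.smul_mem (lam ^ (r + 1))⁻¹ (N.add_mem (N.sub_mem (N.add_mem (N.sub_mem hσ h1) h2)
      (N.smul_mem lam h3)) (N.smul_mem lam h4))
    have hD : σ ((deriv lam)^[i] G) = (deriv lam)^[i] G + lam • (deriv lam)^[i + 1] G := by
      rw [hσdef, IsWeightedDerivation.shift_apply, Function.iterate_succ_apply']
    rw [map_sub, map_mul, map_mul, hD, ← hq] at h5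
    convert h5 using 1
    rw [eq_inv_smul_iff₀ (pow_ne_zero _ hlam)]
    simp only [map_one, one_mul, mul_one, mul_sub, sub_mul, mul_add, add_mul, smul_sub,
      mul_smul_comm, smul_mul_assoc, smul_smul, pow_succ']
    abel

/-! #### Weight zero -/

/-- In weight zero `d` differentiates one letter at a time. Length is preserved, and the first
letter rises by one or is unchanged. -/
theorem deriv_zero_word_mem (w : FreeMonoid ℕ) :
    deriv (0 : k) (wordHom k w) ∈ mspan k (wordHom k)
      {v | v.length = w.length ∧ firstLetter v ≤ firstLetter w + 1} := by
  induction w using FreeMonoid.inductionOn' with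
  | one =>
    rw [map_one, (isWeightedDerivation_deriv (0 : k)).map_one]
    exact Submodule.zero_mem _
  | of_mul m w ih =>
    rw [map_mul, (isWeightedDerivation_deriv (0 : k)).leibniz, zero_smul, add_zero, wordHom_of,
      deriv_ι, ← wordHom_of, ← wordHom_of, ← map_mul]
    refine Submodule.add_mem _ (mem_mspan ⟨rfl, le_rfl⟩) ?_
    refine mul_mem_mspan (P := {FreeMonoid.of m}) (mem_mspan rfl) ih ?_
    rintro _ rfl v ⟨hv, -⟩
    refine ⟨?_, Nat.le_succ _⟩
    rw [FreeMonoid.length_mul, FreeMonoid.length_mul, hv]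

/-- In `d(x^(m) z) = x^(m+1) z + x^(m) d(z)` the second term has the smaller first letter at the
same length. Words below `x^(m) z` are either shorter or have a smaller first letter, and both
properties survive the rise by at most one on each side. -/
theorem hasLead_iterate_zero (hn : 0 < n)
    (hG : HasLead (wordHom k) WordLT (1 : k) (FreeMonoid.of 0 ^ n) G) (m : ℕ) :
    HasLead (wordHom k) WordLT (1 : k) (FreeMonoid.of m * FreeMonoid.of 0 ^ (n - 1))
      ((deriv (0 : k))^[m] G) := by
  induction m with
  | zero => rwa [← pow_succ', Nat.sub_add_cancel hn]
  | succ m ih =>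
    rw [Function.iterate_succ_apply']
    set z := FreeMonoid.of 0 ^ (n - 1) with hz
    have h1 : deriv (0 : k) ((deriv (0 : k))^[m] G - (1 : k) • wordHom k (FreeMonoid.of m * z)) ∈
        mspan k (wordHom k) {v | WordLT v (FreeMonoid.of (m + 1) * z)} := by
      refine map_mem_of_mspan ih _ _ fun v hv => ?_
      refine mspan_mono ?_ (deriv_zero_word_mem v)
      rintro u ⟨hu, hu'⟩
      rw [Set.mem_ofPred_eq, hz, wordLT_of_mul_zero_pow] at hv ⊢
      omega
    have h2 : wordHom k (FreeMonoid.of m) * deriv (0 : k) (wordHom k z) ∈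
        mspan k (wordHom k) {v | WordLT v (FreeMonoid.of (m + 1) * z)} := by
      refine mul_mem_mspan (P := {FreeMonoid.of m}) (mem_mspan rfl) (deriv_zero_word_mem z) ?_
      rintro _ rfl v ⟨hv, -⟩
      exact wordLT_of_mul (Nat.lt_succ_self m) hv
    have h3 := Submodule.add_mem _ h1 h2
    rw [HasLead]
    convert h3 using 1
    rw [one_smul, one_smul, map_sub, map_mul, map_mul,
      (isWeightedDerivation_deriv (0 : k)).leibniz, zero_smul, wordHom_of, wordHom_of, deriv_ι]
    abel

/-- The three Leibniz terms of `d(a D_m b)` keep the length of the leading words or lie lower, and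
raise the first letter by at most one, just as the bounding word does. -/
theorem deriv_zero_mem_smallSpan {i N : ℕ} {p : FreeAlgebra k ℕ} {z : FreeMonoid ℕ}
    (hp : p ∈ smallSpan k (wordHom k) WordLT (fun m => (deriv (0 : k))^[m] G)
      (fun m => FreeMonoid.of m * z) (FreeMonoid.of i * FreeMonoid.of 0 ^ N)) :
    deriv (0 : k) p ∈ smallSpan k (wordHom k) WordLT (fun m => (deriv (0 : k))^[m] G)
      (fun m => FreeMonoid.of m * z) (FreeMonoid.of (i + 1) * FreeMonoid.of 0 ^ N) := by
  refine map_mem_of_smallSpan hp _ _ fun m a b h => ?_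
  -- The first letter of `a x^(m) z b` is `m` when `a` is empty and that of `a` otherwise; the
  -- default value of `firstLetter` on the empty word plays no role.
  have key : ∀ a m b, WordLT (a * (FreeMonoid.of m * z) * b)
      (FreeMonoid.of i * FreeMonoid.of 0 ^ N) ↔
      a.length + (1 + z.length) + b.length < N + 1 ∨
      (a.length + (1 + z.length) + b.length = N + 1 ∧
        (if a.length = 0 then m else firstLetter a) < i) := fun a m b => by
    rw [wordLT_of_mul_zero_pow, mul_assoc, mul_assoc (FreeMonoid.of m), firstLetter_mul]
    simp only [FreeMonoid.length_mul, FreeMonoid.length_of, add_assoc]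
  have key' : ∀ a m b, WordLT (a * (FreeMonoid.of m * z) * b)
      (FreeMonoid.of (i + 1) * FreeMonoid.of 0 ^ N) ↔
      a.length + (1 + z.length) + b.length < N + 1 ∨
      (a.length + (1 + z.length) + b.length = N + 1 ∧
        (if a.length = 0 then m else firstLetter a) < i + 1) := fun a m b => by
    rw [wordLT_of_mul_zero_pow, mul_assoc, mul_assoc (FreeMonoid.of m), firstLetter_mul]
    simp only [FreeMonoid.length_mul, FreeMonoid.length_of, add_assoc]
  rw [key] at h
  rw [(isWeightedDerivation_deriv (0 : k)).leibniz, (isWeightedDerivation_deriv (0 : k)).leibniz,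
    zero_smul, zero_smul, add_zero, add_zero, add_mul,
    ← Function.iterate_succ_apply' (deriv (0 : k))]
  refine Submodule.add_mem _ (Submodule.add_mem _ ?_ ?_) ?_
  · refine mul_mem_smallSpan (D := fun m => (deriv (0 : k))^[m] G) (deriv_zero_word_mem a)
      (mem_mspan (P := {b}) rfl) ?_
    rintro u ⟨hu, hu'⟩ v rfl
    rw [key']
    grind
  · refine mem_smallSpan (D := fun m => (deriv (0 : k))^[m] G) ?_
    rw [key']
    grind
  · refine mul_mem_smallSpan (D := fun m => (deriv (0 : k))^[m] G) (mem_mspan (P := {a}) rfl)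
      (deriv_zero_word_mem b) ?_
    rintro u rfl v ⟨hv, hv'⟩
    rw [key']
    grind

/-- Induction on `i` by applying `d`. Besides the next composition, Leibniz produces terms whose
leading words have the length of the bounding word but begin with `x^(i)` instead of `x^(i+1)`, so
all of them are small. -/
theorem overlap_zero_mem_smallSpan (hn : 0 < n)
    (hcomm : Commute G (FreeAlgebra.ι k 0)) (r i : ℕ) :
    (deriv (0 : k))^[i] G * wordHom k (FreeMonoid.of 0 ^ (r + 1)) -
        wordHom k (FreeMonoid.of i * FreeMonoid.of 0 ^ r) * G ∈
      smallSpan k (wordHom k) WordLT (fun m => (deriv (0 : k))^[m] G)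
        (fun m => FreeMonoid.of m * FreeMonoid.of 0 ^ (n - 1))
        (FreeMonoid.of i * FreeMonoid.of 0 ^ (n + r)) := by
  induction i with
  | zero =>
    rw [← pow_succ' _ r, map_pow, wordHom_of, Function.iterate_zero_apply,
      (hcomm.pow_right (r + 1)).eq, sub_self]
    exact Submodule.zero_mem _
  | succ i ih =>
    have hd := deriv_zero_mem_smallSpan ih
    have hlen : ∀ m, (FreeMonoid.of m * FreeMonoid.of 0 ^ (n - 1)).length = n := fun m => by
      rw [FreeMonoid.length_mul, FreeMonoid.length_of, length_of_pow]
      omega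
    set N := smallSpan k (wordHom k) WordLT (fun m => (deriv (0 : k))^[m] G)
        (fun m => FreeMonoid.of m * FreeMonoid.of 0 ^ (n - 1))
        (FreeMonoid.of (i + 1) * FreeMonoid.of 0 ^ (n + r)) with hN
    have h1 : wordHom k 1 * (deriv (0 : k))^[i] G *
        deriv (0 : k) (wordHom k (FreeMonoid.of 0 ^ (r + 1))) ∈ N := by
      refine mul_mem_smallSpan (D := fun m => (deriv (0 : k))^[m] G) (mem_mspan (P := {1}) rfl)
        (deriv_zero_word_mem _) ?_
      rintro _ rfl v ⟨hv, -⟩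
      rw [one_mul, mul_assoc]
      refine wordLT_of_mul (Nat.lt_succ_self i) ?_
      rw [FreeMonoid.length_mul, hv, length_of_pow, length_of_pow, length_of_pow]
      omega
    have h2 : wordHom k (FreeMonoid.of i) * deriv (0 : k) (wordHom k (FreeMonoid.of 0 ^ r)) *
        (deriv (0 : k))^[0] G * wordHom k 1 ∈ N := by
      refine mul_mem_smallSpan (D := fun m => (deriv (0 : k))^[m] G)
        (P := {u | ∃ v : FreeMonoid ℕ, v.length = r ∧ u = FreeMonoid.of i * v})
        (mul_mem_mspan (P := {FreeMonoid.of i}) (mem_mspan rfl) (deriv_zero_word_mem _) ?_)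
        (mem_mspan (P := {1}) rfl) ?_
      · rintro _ rfl v ⟨hv, -⟩
        exact ⟨v, by rw [hv, length_of_pow], rfl⟩
      · rintro _ ⟨v, hv, rfl⟩ _ rfl
        rw [mul_one, mul_assoc]
        refine wordLT_of_mul (Nat.lt_succ_self i) ?_
        rw [FreeMonoid.length_mul, hv, hlen, length_of_pow]
        omega
    have h3 : wordHom k (FreeMonoid.of i * FreeMonoid.of 0 ^ r) * (deriv (0 : k))^[1] G *
        wordHom k 1 ∈ N := by
      refine mem_smallSpan (D := fun m => (deriv (0 : k))^[m] G) ?_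
      rw [mul_one, mul_assoc]
      refine wordLT_of_mul (Nat.lt_succ_self i) ?_
      rw [FreeMonoid.length_mul, hlen, length_of_pow, length_of_pow]
      omega
    have h4 := N.add_mem (N.add_mem (N.sub_mem hd h1) h2) h3
    convert h4 using 1
    simp only [map_sub, map_mul, (isWeightedDerivation_deriv (0 : k)).leibniz, zero_smul,
      add_zero, Function.iterate_succ_apply', Function.iterate_zero_apply, wordHom_of, deriv_ι,
      map_one, one_mul, mul_one, add_mul]
    abel

end Overlap

/-! ### Compositions, Gröbner-Shirshov basis and linear basis for words -/

section Noncommutative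

variable {k : Type*} [Field k] {lam : k} {n : ℕ} {G : FreeAlgebra k ℕ}

theorem eq_of_pow {w : FreeMonoid ℕ} {r i : ℕ} (h : w.toList = List.replicate r i) :
    w = FreeMonoid.of i ^ r :=
  FreeMonoid.toList.injective (h.trans (toList_of_pow i r).symm)

/-- Describes the ideal as a linear span of word multiples, the form of kernel that the
triangularity argument needs. The nonzero factor `a` allows the generator to be monic. -/
theorem mem_relIdeal_iff (f : k[X]) {a : k} (ha : a ≠ 0) {p : FreeAlgebra k ℕ} :
    p ∈ relIdeal lam f ↔ p ∈ Submodule.span k (Set.range fun t : FreeMonoid ℕ × ℕ × FreeMonoid ℕ =>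
      wordHom k t.1 * (deriv lam)^[t.2.1] (a • rel f) * wordHom k t.2.2) := by
  have hiter : ∀ m, (deriv lam)^[m] (a • rel f) = a • (deriv lam)^[m] (rel f) := fun m =>
    (apply_iterate_comm (ψ := fun x : FreeAlgebra k ℕ => a • x)
      (fun x => ((deriv lam).map_smul a x).symm) m (rel f)).symm
  set N := Submodule.span k (Set.range fun t : FreeMonoid ℕ × ℕ × FreeMonoid ℕ =>
      wordHom k t.1 * (deriv lam)^[t.2.1] (a • rel f) * wordHom k t.2.2) with hN
  have htop : ∀ q : FreeAlgebra k ℕ, q ∈ mspan k (wordHom k) Set.univ := by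
    intro q
    have : mspan k (wordHom k) Set.univ = ⊤ := by
      rw [mspan, Set.image_univ, ← (FreeAlgebra.basisFreeMonoid k ℕ).span_eq]
      congr 2
      exact funext fun v => (basis_apply v).symm
    rw [this]
    trivial
  constructor
  · intro hp
    induction hp using TwoSidedIdeal.span_induction with
    | mem x hx =>
      obtain ⟨m, rfl⟩ := hx
      have : (deriv lam)^[m] (rel f) =
          a⁻¹ • (wordHom k 1 * (deriv lam)^[m] (a • rel f) * wordHom k 1) := by
        rw [map_one, one_mul, mul_one, hiter, smul_smul, inv_mul_cancel₀ ha, one_smul]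
      simp only [this]
      exact N.smul_mem _ (Submodule.subset_span ⟨(1, m, 1), rfl⟩)
    | zero => exact N.zero_mem
    | add x y _ _ hx hy => exact N.add_mem hx hy
    | neg x _ hx => exact N.neg_mem hx
    | left_absorb q x _ hx =>
      refine map_mem_of_mspan (htop q) (LinearMap.mulRight k x) N fun w _ => ?_
      have : N ≤ N.comap (LinearMap.mulLeft k (wordHom k w)) := by
        rw [hN, Submodule.span_le]
        rintro _ ⟨⟨u, m, v⟩, rfl⟩
        refine Submodule.subset_span ⟨(w * u, m, v), ?_⟩
        simp [mul_assoc]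
      exact this hx
    | right_absorb q x _ hx =>
      refine map_mem_of_mspan (htop q) (LinearMap.mulLeft k x) N fun w _ => ?_
      have : N ≤ N.comap (LinearMap.mulRight k (wordHom k w)) := by
        rw [hN, Submodule.span_le]
        rintro _ ⟨⟨u, m, v⟩, rfl⟩
        refine Submodule.subset_span ⟨(u, m, v * w), ?_⟩
        simp [mul_assoc]
      exact this hx
  · intro hp
    induction hp using Submodule.span_induction with
    | zero => exact TwoSidedIdeal.zero_mem _
    | add x y _ _ hx hy => exact TwoSidedIdeal.add_mem _ hx hy
    | smul c x _ hx => exact smul_mem_twoSidedIdeal _ c hx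
    | mem x hx =>
      obtain ⟨⟨u, m, v⟩, rfl⟩ := hx
      simp only [hiter]
      exact TwoSidedIdeal.mul_mem_right _ _ _ (TwoSidedIdeal.mul_mem_left _ _ _
        (smul_mem_twoSidedIdeal _ a (TwoSidedIdeal.subset_span ⟨m, rfl⟩)))

theorem hasLead_rel {f : k[X]} (hf : f.natDegree = n) :
    HasLead (wordHom k) WordLT f.leadingCoeff (FreeMonoid.of 0 ^ n) (rel f) := by
  rw [rel, ← wordHom_of, ← hf]
  refine HasLead.aeval f fun i hi => wordLT_of_length_lt ?_
  rwa [length_of_pow, length_of_pow]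

theorem monicPart_rel {f : k[X]} (hn : 0 < n) (hf : f.natDegree = n) :
    f.leadingCoeff ≠ 0 ∧ monicPart (rel f) = f.leadingCoeff⁻¹ • rel f := by
  have h0 : f.leadingCoeff ≠ 0 := by
    rw [Ne, leadingCoeff_eq_zero]
    rintro rfl
    rw [natDegree_zero] at hf
    omega
  exact ⟨h0, by rw [monicPart, leadCoeff_of_hasLead h0 (hasLead_rel hf)]⟩

theorem monicPart_rel_of_monic {f : k[X]} (hn : 0 < n) (hf : f.natDegree = n) (h : f.Monic) :
    monicPart (rel f) = rel f := by
  rw [(monicPart_rel hn hf).2, h.leadingCoeff, inv_one, one_smul]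

theorem diffIdeal_monicPart_rel {f : k[X]} (hn : 0 < n) (hf : f.natDegree = n) :
    diffIdeal lam {monicPart (rel f)} = diffIdeal lam {rel f} := by
  rw [(monicPart_rel hn hf).2, diffIdeal_smul (inv_ne_zero (monicPart_rel hn hf).1)]

theorem hasLead_monicPart_rel {f : k[X]} (hn : 0 < n) (hf : f.natDegree = n) :
    HasLead (wordHom k) WordLT (1 : k) (FreeMonoid.of 0 ^ n) (monicPart (rel f)) := by
  obtain ⟨h0, h⟩ := monicPart_rel hn hf
  have := (hasLead_rel hf).smul f.leadingCoeff⁻¹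
  rwa [inv_mul_cancel₀ h0, ← h] at this

/-- The base case of both overlap inductions. -/
theorem commute_monicPart_rel (f : k[X]) :
    Commute (monicPart (rel f)) (FreeAlgebra.ι k 0) := by
  have := (Commute.all f X).map (aeval (FreeAlgebra.ι k 0))
  rw [aeval_X] at this
  exact this.smul_left _

variable [DecidableEq k]

/-- The leading word of the `m`-th derivative of a polynomial of degree `n` in `x^(0)`. -/
def relLead (lam : k) (n m : ℕ) : FreeMonoid ℕ :=
  FreeMonoid.of m * FreeMonoid.of (if lam = 0 then 0 else m) ^ (n - 1)

theorem length_relLead (hn : 0 < n) (m : ℕ) : (relLead lam n m).length = n := by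
  rw [relLead, FreeMonoid.length_mul, FreeMonoid.length_of, length_of_pow]
  omega

theorem toList_relLead (m : ℕ) : (relLead lam n m).toList =
    m :: List.replicate (n - 1) (if lam = 0 then 0 else m) := by
  rw [relLead, FreeMonoid.toList_mul, toList_of_pow]
  rfl

theorem relLead_injective {i j : ℕ} (h : relLead lam n i = relLead lam n j) : i = j := by
  have := congrArg FreeMonoid.toList h
  rw [toList_relLead, toList_relLead] at this
  exact (List.cons.inj this).1

theorem relLead_of_ne_zero (hlam : lam ≠ 0) (hn : 0 < n) (m : ℕ) :
    relLead lam n m = FreeMonoid.of m ^ n := by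
  rw [relLead, if_neg hlam, ← pow_succ', Nat.sub_add_cancel hn]

theorem relLead_zero (m : ℕ) :
    relLead (0 : k) n m = FreeMonoid.of m * FreeMonoid.of 0 ^ (n - 1) := by
  rw [relLead, if_pos rfl]

/-- If the two occurrences did not meet, `u` would contain the whole second word of length `n`. The
bound on `u` thus yields a nonempty common part `t`. -/
theorem exists_of_overlap (hn : 0 < n) {i j : ℕ} {u v : FreeMonoid ℕ}
    (h : relLead lam n i * u = v * relLead lam n j) (hu : u.length < n) :
    ∃ t : FreeMonoid ℕ, t ≠ 1 ∧ relLead lam n i = v * t ∧ relLead lam n j = t * u := by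
  have hl := congrArg FreeMonoid.length h
  rw [FreeMonoid.length_mul, FreeMonoid.length_mul, length_relLead hn, length_relLead hn] at hl
  rcases List.append_eq_append_iff.1 (congrArg FreeMonoid.toList h) with ⟨t, -, ht⟩ | ⟨t, h1, h2⟩
  · have := congrArg List.length ht
    rw [List.length_append] at this
    have h3 : (relLead lam n j).toList.length = n := length_relLead hn j
    have h4 : u.toList.length = u.length := rfl
    omega
  · refine ⟨FreeMonoid.ofList t, ?_, FreeMonoid.toList.injective h1,
      FreeMonoid.toList.injective h2⟩
    intro ht
    have ht' : t = [] := ht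
    subst ht'
    have h3 : (relLead lam n j).toList.length = n := length_relLead hn j
    rw [h2] at h3
    exact hu.ne h3

/-- The leading coefficients of the derivatives, and the triviality of the overlaps. -/
theorem exists_leadCoeff_overlap (lam : k) (hn : 0 < n)
    (hG : HasLead (wordHom k) WordLT (1 : k) (FreeMonoid.of 0 ^ n) G)
    (hcomm : Commute G (FreeAlgebra.ι k 0)) :
    ∃ c : ℕ → k, (∀ m, c m ≠ 0) ∧
      (∀ m, HasLead (wordHom k) WordLT (c m) (relLead lam n m) ((deriv lam)^[m] G)) ∧
      ∀ i j u v, relLead lam n i * u = v * relLead lam n j → u.length < n →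
        (c i)⁻¹ • ((deriv lam)^[i] G * wordHom k u) -
            (c j)⁻¹ • (wordHom k v * (deriv lam)^[j] G) ∈
          smallSpan k (wordHom k) WordLT (fun m => (deriv lam)^[m] G) (relLead lam n)
            (relLead lam n i * u) := by
  by_cases hlam : lam = 0
  · subst hlam
    refine ⟨fun _ => 1, fun _ => one_ne_zero, fun m => ?_, fun i j u v h hu => ?_⟩
    · rw [relLead_zero]
      exact hasLead_iterate_zero hn hG m
    obtain ⟨t, ht, h1, h2⟩ := exists_of_overlap hn h hu
    have h1' := congrArg FreeMonoid.toList h1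
    have h2' := congrArg FreeMonoid.toList h2
    rw [toList_relLead, if_pos rfl, FreeMonoid.toList_mul] at h1' h2'
    rw [inv_one, one_smul, one_smul]
    cases v using FreeMonoid.casesOn with
    -- Total overlap: both words coincide, so the indices agree and the composition is zero.
    | one =>
      have hl := congrArg FreeMonoid.length h
      rw [FreeMonoid.length_mul, FreeMonoid.length_mul, length_relLead hn, length_relLead hn,
        FreeMonoid.length_one, zero_add, Nat.add_eq_left, FreeMonoid.length_eq_zero] at hl
      subst hl
      rw [mul_one, one_mul] at h
      rw [relLead_injective h, map_one, mul_one, mul_one, one_mul, sub_self]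
      exact Submodule.zero_mem _
    | of_mul a v =>
      cases t using FreeMonoid.casesOn with
      | one => exact absurd rfl ht
      | of_mul b t =>
        obtain ⟨ha, h3⟩ := List.cons.inj (show i :: List.replicate (n - 1) 0 =
          a :: (v.toList ++ b :: t.toList) from h1')
        obtain ⟨hb, h4⟩ := List.cons.inj (show j :: List.replicate (n - 1) 0 =
          b :: (t.toList ++ u.toList) from h2')
        obtain ⟨-, hv, ht0⟩ := List.append_eq_replicate_iff.1 h3.symm
        obtain ⟨-, -, hu0⟩ := List.append_eq_replicate_iff.1 h4.symm
        -- The second word starts inside the tail of the first, which consists of `x^(0)`. Hence `j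
        -- = 0`, and `u`, `v` are determined by a single exponent `r`.
        have hb0 : b = 0 := List.eq_of_mem_replicate (ht0 ▸ List.mem_cons_self)
        have hlen : u.toList.length = v.toList.length + 1 := by
          have hl := congrArg FreeMonoid.length h
          rw [FreeMonoid.length_mul, FreeMonoid.length_mul, FreeMonoid.length_mul,
            length_relLead hn, length_relLead hn, FreeMonoid.length_of] at hl
          change u.length = v.length + 1
          omega
        rw [hlen] at hu0
        subst ha
        generalize v.toList.length = r at hv hu0
        rw [hb, hb0, eq_of_pow hu0, eq_of_pow hv, Function.iterate_zero_apply]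
        have := overlap_zero_mem_smallSpan hn hcomm r i
        have hw : relLead (0 : k) n i * FreeMonoid.of 0 ^ (r + 1) =
            FreeMonoid.of i * FreeMonoid.of 0 ^ (n + r) := by
          rw [relLead_zero, mul_assoc, ← pow_add]
          congr 2
          omega
        rw [hw, show relLead (0 : k) n = _ from funext relLead_zero]
        exact this
  · have hL : relLead lam n = fun m => FreeMonoid.of m ^ n :=
      funext (relLead_of_ne_zero hlam hn)
    choose c hc hD using exists_hasLead_iterate hlam hn hG
    refine ⟨c, hc, fun m => by rw [relLead_of_ne_zero hlam hn]; exact hD m, fun i j u v h hu => ?_⟩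
    obtain ⟨t, ht, h1, h2⟩ := exists_of_overlap hn h hu
    have hl := congrArg FreeMonoid.length h
    rw [FreeMonoid.length_mul, FreeMonoid.length_mul, length_relLead hn, length_relLead hn] at hl
    have h1' := congrArg FreeMonoid.toList h1
    have h2' := congrArg FreeMonoid.toList h2
    rw [relLead_of_ne_zero hlam hn, toList_of_pow, FreeMonoid.toList_mul] at h1' h2'
    obtain ⟨-, hv, hti⟩ := List.append_eq_replicate_iff.1 h1'.symm
    obtain ⟨-, htj, hu0⟩ := List.append_eq_replicate_iff.1 h2'.symm
    obtain ⟨b, hb⟩ := List.exists_mem_of_ne_nil t.toList fun h => ht (FreeMonoid.toList.injective h)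
    -- A letter of the common part equals both `x^(i)` and `x^(j)`.
    have hij : i = j := by
      have hb' := hb
      rw [hti] at hb
      rw [htj] at hb'
      exact (List.eq_of_mem_replicate hb).symm.trans (List.eq_of_mem_replicate hb')
    subst hij
    have hlen : v.toList.length = u.toList.length := by
      change v.length = u.length
      omega
    rw [hlen] at hv
    have hw : relLead lam n i * FreeMonoid.of i ^ u.toList.length =
        FreeMonoid.of i ^ (n + u.toList.length) := by
      rw [relLead_of_ne_zero hlam hn, ← pow_add]
    have := overlap_mem_smallSpan hlam hn hcomm u.toList.length i
    rw [← eq_of_pow hu0] at hw this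
    rw [eq_of_pow hv, ← eq_of_pow hu0, ← smul_sub, hw, hL]
    exact Submodule.smul_mem _ _ this

/-- All compositions of multiples of the derivatives are trivial if the overlaps are. -/
theorem composition_of_overlap (hn : 0 < n) {D : ℕ → FreeAlgebra k ℕ} {c : ℕ → k}
    (hc : ∀ m, c m ≠ 0) (hD : ∀ m, HasLead (wordHom k) WordLT (c m) (relLead lam n m) (D m))
    (hov : ∀ i j u v, relLead lam n i * u = v * relLead lam n j → u.length < n →
        (c i)⁻¹ • (D i * wordHom k u) - (c j)⁻¹ • (wordHom k v * D j) ∈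
          smallSpan k (wordHom k) WordLT D (relLead lam n) (relLead lam n i * u))
    (i j : ℕ) (x y x' y' : FreeMonoid ℕ)
    (h : x * relLead lam n i * y = x' * relLead lam n j * y') :
    (c i)⁻¹ • (wordHom k x * D i * wordHom k y) - (c j)⁻¹ • (wordHom k x' * D j * wordHom k y') ∈
      smallSpan k (wordHom k) WordLT D (relLead lam n) (x * relLead lam n i * y) := by
  -- By antisymmetry of the composition, the first occurrence may be assumed to start no later than
  -- the second; `t` is the offset between the starting positions.
  have key : ∀ i j (x t y y' : FreeMonoid ℕ),
      relLead lam n i * y = t * relLead lam n j * y' →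
      (c i)⁻¹ • (wordHom k x * D i * wordHom k y) -
          (c j)⁻¹ • (wordHom k (x * t) * D j * wordHom k y') ∈
        smallSpan k (wordHom k) WordLT D (relLead lam n) (x * relLead lam n i * y) := by
    intro i j x t y y' h
    have hmul : ∀ s : FreeMonoid ℕ, y = s * y' →
        (c i)⁻¹ • (D i * wordHom k s) - (c j)⁻¹ • (wordHom k t * D j) ∈
          smallSpan k (wordHom k) WordLT D (relLead lam n) (relLead lam n i * s) →
        (c i)⁻¹ • (wordHom k x * D i * wordHom k y) -
          (c j)⁻¹ • (wordHom k (x * t) * D j * wordHom k y') ∈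
        smallSpan k (wordHom k) WordLT D (relLead lam n) (x * relLead lam n i * y) := by
      rintro s rfl hs
      have := mul_smallSpan_mul isMulOrder_wordLT x y' hs
      simp only [mul_sub, sub_mul, mul_smul_comm, smul_mul_assoc, mul_assoc, map_mul] at this ⊢
      exact this
    rcases List.append_eq_append_iff.1 (congrArg FreeMonoid.toList h) with
      ⟨s, h1, h2⟩ | ⟨s, h1, h2⟩
    · have hy : y = FreeMonoid.ofList s * y' := FreeMonoid.toList.injective h2
      have hs : t * relLead lam n j = relLead lam n i * FreeMonoid.ofList s :=
        FreeMonoid.toList.injective h1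
      refine hmul _ hy ?_
      by_cases hsn : (FreeMonoid.ofList s).length < n
      · exact hov i j _ _ hs.symm hsn
      -- Now `s` has length at least `n`, so the occurrences are disjoint, possibly adjacent, with
      -- `z` the word between them.
      obtain ⟨z, hz, hz'⟩ : ∃ z : FreeMonoid ℕ, t = relLead lam n i * z ∧
          FreeMonoid.ofList s = z * relLead lam n j := by
        rcases List.append_eq_append_iff.1 (congrArg FreeMonoid.toList hs) with
          ⟨z, h3, h4⟩ | ⟨z, h3, h4⟩
        · have hl : (relLead lam n j).toList.length = n := length_relLead hn j
          rw [h4, List.length_append] at hl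
          have hs' : (FreeMonoid.toList (FreeMonoid.ofList s)).length =
            (FreeMonoid.ofList s).length := rfl
          have hz : z = [] := List.eq_nil_of_length_eq_zero (by omega)
          subst hz
          refine ⟨1, FreeMonoid.toList.injective ?_, FreeMonoid.toList.injective h4.symm⟩
          rw [List.append_nil] at h3
          rw [mul_one]
          exact h3.symm
        · exact ⟨FreeMonoid.ofList z, FreeMonoid.toList.injective h3,
            FreeMonoid.toList.injective h4⟩
      rw [hz, hz', ← mul_assoc]
      exact disjoint_composition isMulOrder_wordLT hc hD i j z
    -- The second occurrence lies inside the first. Equal lengths make them coincide.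
    · have hi : relLead lam n i = t * relLead lam n j * FreeMonoid.ofList s :=
        FreeMonoid.toList.injective h1
      have hl := congrArg FreeMonoid.length hi
      rw [FreeMonoid.length_mul, FreeMonoid.length_mul, length_relLead hn, length_relLead hn] at hl
      have ht : t = 1 := FreeMonoid.length_eq_zero.1 (by omega)
      have hs : FreeMonoid.ofList s = 1 := FreeMonoid.length_eq_zero.1 (by omega)
      rw [ht, hs, one_mul, mul_one] at hi
      have hij := relLead_injective hi
      subst hij
      rw [ht, one_mul] at h
      rw [mul_left_cancel h, ht, mul_one, sub_self]
      exact Submodule.zero_mem _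
  have h' : x * (relLead lam n i * y) = x' * (relLead lam n j * y') := by
    rw [← mul_assoc, ← mul_assoc, h]
  rcases List.append_eq_append_iff.1 (congrArg FreeMonoid.toList h') with
    ⟨t, h1, h2⟩ | ⟨t, h1, h2⟩
  · have hx : x' = x * FreeMonoid.ofList t := FreeMonoid.toList.injective h1
    subst hx
    refine key i j x _ y y' ?_
    rw [mul_assoc]
    exact FreeMonoid.toList.injective h2
  · have hx : x = x' * FreeMonoid.ofList t := FreeMonoid.toList.injective h1
    subst hx
    rw [h, ← neg_sub]
    refine Submodule.neg_mem _ (key j i x' _ y' y ?_)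
    rw [mul_assoc]
    exact FreeMonoid.toList.injective h2

/-- The length bound on `w` says exactly that `u` is shorter than `n`, which is the overlap
hypothesis. An inclusion between leading words of equal length is an equality and gives zero. -/
theorem isGSBasis_of_overlap (hn : 0 < n) {c : ℕ → k}
    (hG : HasLead (wordHom k) WordLT (1 : k) (FreeMonoid.of 0 ^ n) G)
    (hc : ∀ m, c m ≠ 0)
    (hD : ∀ m, HasLead (wordHom k) WordLT (c m) (relLead lam n m) ((deriv lam)^[m] G))
    (hov : ∀ i j u v, relLead lam n i * u = v * relLead lam n j → u.length < n →
        (c i)⁻¹ • ((deriv lam)^[i] G * wordHom k u) -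
            (c j)⁻¹ • (wordHom k v * (deriv lam)^[j] G) ∈
          smallSpan k (wordHom k) WordLT (fun m => (deriv lam)^[m] G) (relLead lam n)
            (relLead lam n i * u)) : IsGSBasis lam {G} := by
  have hL : ∀ m, leadWord ((deriv lam)^[m] G) = relLead lam n m := fun m =>
    leadWord_of_hasLead (hc m) (hD m)
  have hM : ∀ m, monicPart ((deriv lam)^[m] G) = (c m)⁻¹ • (deriv lam)^[m] G := fun m => by
    rw [monicPart, leadCoeff_of_hasLead (hc m) (hD m)]
  have hlen : (leadWord G).length = n := by
    rw [leadWord_of_hasLead one_ne_zero hG, length_of_pow]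
  constructor
  · rintro _ rfl
    exact leadCoeff_of_hasLead one_ne_zero hG
  · rintro _ rfl _ rfl i j u v w - - hw hw' hl
    rw [hL] at hw hw'
    rw [hlen, hw, FreeMonoid.length_mul, length_relLead hn] at hl
    have := hov i j u v (hw ▸ hw') (by omega)
    rw [hM, hM, smul_mul_assoc, mul_smul_comm, hw]
    refine (?_ : smallSpan k (wordHom k) WordLT _ _ _ ≤ _) this
    rw [smallSpan, Submodule.span_le]
    rintro _ ⟨m, a, b, hm, rfl⟩
    exact Submodule.subset_span ⟨_, rfl, m, a, b, by rwa [hL], rfl⟩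
  · rintro _ rfl _ rfl i j a b w - - hw hw'
    rw [hL] at hw hw'
    have h := hw.symm.trans hw'
    have hl := congrArg FreeMonoid.length h
    rw [FreeMonoid.length_mul, FreeMonoid.length_mul, length_relLead hn, length_relLead hn] at hl
    have ha : a = 1 := FreeMonoid.length_eq_zero.1 (by omega)
    have hb : b = 1 := FreeMonoid.length_eq_zero.1 (by omega)
    rw [ha, hb, one_mul, mul_one] at h
    rw [relLead_injective h, ha, hb, ← wordHom_apply, map_one, one_mul, mul_one, sub_self]
    exact Submodule.zero_mem _

/-- The noncommutative part: the Gröbner-Shirshov basis, the irreducible words, and the basis. -/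
theorem noncommutative_groebnerShirshov {f : k[X]} (hn : 0 < n) (hf : f.natDegree = n) (lam : k) :
    IsGSBasis lam {monicPart (rel f)} ∧
    DIrr lam {monicPart (rel f)} =
      {w | ∀ m : ℕ, ¬ ∃ a b : FreeMonoid ℕ, w = a * relLead lam n m * b} ∧
    ∃ B : Module.Basis (DIrr lam {monicPart (rel f)}) k (RelQuotient lam f),
      ∀ w, B w = proj lam f (word w.1) := by
  have hG := hasLead_monicPart_rel hn hf
  obtain ⟨c, hc, hD, hov⟩ := exists_leadCoeff_overlap lam hn hG (commute_monicPart_rel f)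
  have hirr : DIrr lam {monicPart (rel f)} =
      {w | ∀ m : ℕ, ¬ ∃ a b : FreeMonoid ℕ, w = a * relLead lam n m * b} := by
    ext w
    simp only [DIrr, Set.mem_singleton_iff, exists_eq_left, Set.mem_ofPred_eq, not_exists, not_and,
      leadWord_of_hasLead (hc _) (hD _)]
    exact forall_congr' fun m => forall₂_congr fun a b =>
      ⟨fun h => h (ne_zero_of_hasLead (hc m) (hD m)), fun h _ => h⟩
  refine ⟨isGSBasis_of_overlap hn hG hc hD hov, hirr, ?_⟩
  refine exists_basis_of_smallSpan (W := wordHom k) isMulOrder_wordLT wordLT_wf wordLT_tri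
    (FreeAlgebra.basisFreeMonoid k ℕ) basis_apply hc hD
    (composition_of_overlap hn hc hD hov) (proj lam f).toLinearMap (proj_surjective f) ?_ _ ?_
  · ext p
    obtain ⟨h0, h⟩ := monicPart_rel hn hf
    rw [h, ← mem_relIdeal_iff f (inv_ne_zero h0)]
    exact proj_eq_zero f
  · intro w
    rw [hirr, Set.mem_ofPred_eq]
    exact not_exists.symm

end Noncommutative

/-! ### The order on commutative monomials -/

section Commutative

/-- The order on monomials, written multiplicatively. -/
def MonoMulLT (u v : Multiplicative (ℕ →₀ ℕ)) : Prop :=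
  MonoLT u.toAdd v.toAdd

/-- The order is the lexicographic product of the degree with the lexicographic order on exponent
vectors read from the largest index down. The latter is well-founded because the indices themselves
are well-ordered upwards. -/
theorem monoMulLT_wf : WellFounded MonoMulLT := by
  have h1 : WellFounded (Finsupp.Lex (· > ·) (· < ·) : (ℕ →₀ ℕ) → (ℕ →₀ ℕ) → Prop) :=
    Finsupp.Lex.wellFounded' (fun _ => Nat.not_lt_zero _) Nat.lt_wfRel.wf Nat.lt_wfRel.wf
  have h2 := WellFounded.prod_lex Nat.lt_wfRel.wf h1
  refine Subrelation.wf ?_ (InvImage.wf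
    (fun u : Multiplicative (ℕ →₀ ℕ) => (u.toAdd.degree, u.toAdd)) h2)
  rintro u v (h | ⟨h, m, hm, hm'⟩)
  · exact Prod.Lex.left _ _ h
  · exact Prod.lex_def.2 (Or.inr ⟨h, m, hm', hm⟩)

theorem MonoLT.add_left {u v : ℕ →₀ ℕ} (a : ℕ →₀ ℕ) (h : MonoLT u v) : MonoLT (a + u) (a + v) := by
  rcases h with h | ⟨h, m, hm, hm'⟩
  · exact Or.inl (by rw [map_add, map_add]; omega)
  · refine Or.inr ⟨by rw [map_add, map_add, h], m, ?_, fun j hj => ?_⟩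
    · rw [Finsupp.add_apply, Finsupp.add_apply]
      omega
    · rw [Finsupp.add_apply, Finsupp.add_apply, hm' j hj]

theorem isMulOrder_monoMulLT : IsMulOrder MonoMulLT where
  trans u v w := MonoLT.trans _ _ _
  mul_left a u v h := MonoLT.add_left a.toAdd h
  mul_right a u v h := by
    rw [mul_comm u, mul_comm v]
    exact MonoLT.add_left a.toAdd h

theorem monoMulLT_tri (u v : Multiplicative (ℕ →₀ ℕ)) :
    MonoMulLT u v ∨ u = v ∨ MonoMulLT v u :=
  MonoLT.trichotomous u.toAdd v.toAdd

theorem MonoLT.mapDomain_succ {u v : ℕ →₀ ℕ} (h : MonoLT u v) :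
    MonoLT (u.mapDomain Nat.succ) (v.mapDomain Nat.succ) := by
  rw [MonoLT, Finsupp.degree_mapDomain, Finsupp.degree_mapDomain]
  refine h.imp id fun ⟨h, m, hm, hm'⟩ => ⟨h, m + 1, ?_, fun j hj => ?_⟩
  · rwa [← Nat.succ_eq_add_one, Finsupp.mapDomain_apply Nat.succ_injective,
      Finsupp.mapDomain_apply Nat.succ_injective]
  · obtain ⟨j, rfl⟩ := Nat.exists_eq_succ_of_ne_zero (Nat.ne_zero_of_lt hj)
    rw [Finsupp.mapDomain_apply Nat.succ_injective, Finsupp.mapDomain_apply Nat.succ_injective]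
    exact hm' j (Nat.lt_of_succ_lt_succ hj)

theorem monoLT_single {i j n : ℕ} (hn : 0 < n) (h : i < j) :
    MonoLT (Finsupp.single i n) (Finsupp.single j n) := by
  refine Or.inr ⟨by rw [Finsupp.degree_single, Finsupp.degree_single], j, ?_, fun l hl => ?_⟩
  · rw [Finsupp.single_eq_same, Finsupp.single_eq_of_ne h.ne']
    exact hn
  · rw [Finsupp.single_eq_of_ne (h.trans hl).ne', Finsupp.single_eq_of_ne hl.ne']

/-! ### Leading monomials in the commutative polynomial algebra -/

variable {k : Type*} [Field k]

/-- Monomials in the polynomial algebra as a homomorphism of monoids. -/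
noncomputable abbrev monoHom (k : Type*) [Field k] :
    Multiplicative (ℕ →₀ ℕ) →* MvPolynomial ℕ k :=
  MvPolynomial.monomialOneHom k ℕ

/-- The basis of monomials. -/
noncomputable def monoBasis (k : Type*) [Field k] :
    Module.Basis (Multiplicative (ℕ →₀ ℕ)) k (MvPolynomial ℕ k) :=
  (MvPolynomial.basisMonomials ℕ k).reindex Multiplicative.ofAdd

theorem monoBasis_apply (w : Multiplicative (ℕ →₀ ℕ)) : monoBasis k w = monoHom k w := by
  rw [monoBasis, Module.Basis.reindex_apply, MvPolynomial.coe_basisMonomials]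
  rfl

theorem isLeadMono_of_hasLead {c : k} (hc : c ≠ 0) {w : Multiplicative (ℕ →₀ ℕ)}
    {p : MvPolynomial ℕ k} (h : HasLead (monoHom k) MonoMulLT c w p) :
    IsLeadMono p w.toAdd ∧ p.coeff w.toAdd = c := by
  have hW : (monoHom k : Multiplicative (ℕ →₀ ℕ) → MvPolynomial ℕ k) = monoBasis k :=
    funext fun v => (monoBasis_apply v).symm
  rw [HasLead, mspan, hW] at h
  have hsupp := (Module.Basis.mem_span_image _).1 h
  have hcoeff : ∀ v : ℕ →₀ ℕ, ¬ MonoLT v w.toAdd →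
      p.coeff v = Finsupp.single w c (Multiplicative.ofAdd v) := by
    intro v hv
    by_contra hne
    refine hv (hsupp (a := Multiplicative.ofAdd v) (Finsupp.mem_support_iff.2 ?_))
    rw [map_sub, map_smul, Module.Basis.repr_self, Finsupp.sub_apply, Finsupp.smul_single,
      smul_eq_mul, mul_one]
    exact sub_ne_zero.2 hne
  have hw : p.coeff w.toAdd = c := by
    rw [hcoeff _ (MonoLT.irrefl _), ofAdd_toAdd, Finsupp.single_eq_same]
  refine ⟨⟨hw ▸ hc, fun v hv => ?_⟩, hw⟩
  by_contra! hne
  rw [hcoeff v hne.2, Finsupp.single_eq_of_ne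
    (show Multiplicative.ofAdd v ≠ w from hne.1)] at hv
  exact hv rfl

theorem ne_zero_of_hasLead_mono {c : k} (hc : c ≠ 0) {w : Multiplicative (ℕ →₀ ℕ)}
    {p : MvPolynomial ℕ k} (h : HasLead (monoHom k) MonoMulLT c w p) : p ≠ 0 := by
  rintro rfl
  exact (isLeadMono_of_hasLead hc h).1.1 (by simp)

theorem leadMono_of_hasLead {c : k} (hc : c ≠ 0) {w : Multiplicative (ℕ →₀ ℕ)}
    {p : MvPolynomial ℕ k} (h : HasLead (monoHom k) MonoMulLT c w p) : leadMono p = w.toAdd :=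
  (isLeadMono_leadMono (ne_zero_of_hasLead_mono hc h)).unique (isLeadMono_of_hasLead hc h).1

theorem cLeadCoeff_of_hasLead {c : k} (hc : c ≠ 0) {w : Multiplicative (ℕ →₀ ℕ)}
    {p : MvPolynomial ℕ k} (h : HasLead (monoHom k) MonoMulLT c w p) : cLeadCoeff p = c := by
  rw [cLeadCoeff, leadMono_of_hasLead hc h, (isLeadMono_of_hasLead hc h).2]

/-! ### Leading monomials of the derivatives -/

variable {lam : k} {n : ℕ} {G : MvPolynomial ℕ k}

/-- The monomial `(x^(m)) ^ n`. -/
noncomputable def cRelLead (n m : ℕ) : Multiplicative (ℕ →₀ ℕ) :=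
  Multiplicative.ofAdd (Finsupp.single m n)

theorem monoHom_cRelLead_one (m : ℕ) : monoHom k (cRelLead 1 m) = MvPolynomial.X m := rfl

theorem cRelLead_one_pow (n m : ℕ) : cRelLead 1 m ^ n = cRelLead n m := by
  rw [cRelLead, ← ofAdd_nsmul, Finsupp.smul_single, smul_eq_mul, mul_one, cRelLead]

/-- The endomorphism of the monoid of monomials that raises all the orders of derivation. -/
noncomputable def monoShift : Multiplicative (ℕ →₀ ℕ) →* Multiplicative (ℕ →₀ ℕ) :=
  AddMonoidHom.toMultiplicative (Finsupp.mapDomain.addMonoidHom Nat.succ)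

theorem monoShift_cRelLead (n m : ℕ) : monoShift (cRelLead n m) = cRelLead n (m + 1) :=
  congrArg Multiplicative.ofAdd (Finsupp.mapDomain_single (f := Nat.succ))

/-- As for words, `1 + lam d` is multiplicative and leads at `lam x^(m+1)` on the variable `x^(m)`.
The monomial is then built up from powers of single variables. -/
theorem hasLead_shift_mono (lam : k) (w : Multiplicative (ℕ →₀ ℕ)) :
    HasLead (monoHom k) MonoMulLT (lam ^ w.toAdd.degree) (monoShift w)
      ((isWeightedDerivation_cDeriv lam).shift (monoHom k w)) := by
  have hone : HasLead (monoHom k) MonoMulLT (1 : k) (monoShift 1)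
      ((isWeightedDerivation_cDeriv lam).shift (monoHom k 1)) := by
    rw [map_one, map_one, map_one, ← map_one (monoHom k)]
    exact hasLead_self 1
  have hmul : ∀ u v : Multiplicative (ℕ →₀ ℕ),
      HasLead (monoHom k) MonoMulLT (lam ^ u.toAdd.degree) (monoShift u)
        ((isWeightedDerivation_cDeriv lam).shift (monoHom k u)) →
      HasLead (monoHom k) MonoMulLT (lam ^ v.toAdd.degree) (monoShift v)
        ((isWeightedDerivation_cDeriv lam).shift (monoHom k v)) →
      HasLead (monoHom k) MonoMulLT (lam ^ (u * v).toAdd.degree) (monoShift (u * v))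
        ((isWeightedDerivation_cDeriv lam).shift (monoHom k (u * v))) := by
    intro u v hu hv
    have := hu.mul isMulOrder_monoMulLT hv
    rw [toAdd_mul, map_add, pow_add, map_mul, map_mul, map_mul]
    exact this
  have hX : ∀ m, HasLead (monoHom k) MonoMulLT lam (monoShift (cRelLead 1 m))
      ((isWeightedDerivation_cDeriv lam).shift (monoHom k (cRelLead 1 m))) := by
    intro m
    rw [monoShift_cRelLead, IsWeightedDerivation.shift_apply, monoHom_cRelLead_one, cDeriv_X,
      ← monoHom_cRelLead_one, ← monoHom_cRelLead_one]
    have h1 := (hasLead_self (k := k) (W := monoHom k) (lt := MonoMulLT)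
      (cRelLead 1 m)).of_lt isMulOrder_monoMulLT
      (show MonoMulLT (cRelLead 1 m) (cRelLead 1 (m + 1)) from
        monoLT_single one_pos (Nat.lt_succ_self m))
    have h2 := (hasLead_self (k := k) (W := monoHom k) (lt := MonoMulLT)
      (cRelLead 1 (m + 1))).smul lam
    simpa using h1.add h2
  change HasLead (monoHom k) MonoMulLT (lam ^ w.toAdd.degree)
    (monoShift (Multiplicative.ofAdd w.toAdd))
    ((isWeightedDerivation_cDeriv lam).shift (monoHom k (Multiplicative.ofAdd w.toAdd)))
  induction w.toAdd using Finsupp.induction_linear with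
  | zero => simpa using hone
  | add u v hu hv => exact hmul (Multiplicative.ofAdd u) (Multiplicative.ofAdd v) hu hv
  | single m n =>
    induction n with
    | zero => simpa using hone
    | succ n ih =>
      rw [Finsupp.single_add]
      have h1 : HasLead (monoHom k) MonoMulLT (lam ^ (cRelLead 1 m).toAdd.degree)
          (monoShift (cRelLead 1 m))
          ((isWeightedDerivation_cDeriv lam).shift (monoHom k (cRelLead 1 m))) := by
        rw [cRelLead, toAdd_ofAdd, Finsupp.degree_single, pow_one]
        exact hX m
      exact hmul (Multiplicative.ofAdd (Finsupp.single m n)) (cRelLead 1 m) ih h1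

theorem exists_hasLead_cDeriv_iterate (hlam : lam ≠ 0) (hn : 0 < n)
    (hG : HasLead (monoHom k) MonoMulLT (1 : k) (cRelLead n 0) G) (m : ℕ) :
    ∃ c : k, c ≠ 0 ∧ HasLead (monoHom k) MonoMulLT c (cRelLead n m) ((cDeriv lam)^[m] G) :=
  (isWeightedDerivation_cDeriv lam).exists_hasLead_iterate hlam isMulOrder_monoMulLT
    (fun _ _ => MonoLT.mapDomain_succ) (fun w => pow_ne_zero w.toAdd.degree hlam)
    (hasLead_shift_mono lam) (monoShift_cRelLead n)
    (fun m => monoLT_single hn (Nat.lt_succ_self m)) hG m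

theorem hasLead_cRel {f : k[X]} (hf : f.natDegree = n) :
    HasLead (monoHom k) MonoMulLT f.leadingCoeff (cRelLead n 0) (cRel f) := by
  rw [cRel, ← monoHom_cRelLead_one, ← cRelLead_one_pow, ← hf]
  refine HasLead.aeval f fun i hi => ?_
  rw [cRelLead_one_pow, cRelLead_one_pow]
  refine Or.inl ?_
  change (Finsupp.single 0 i).degree < (Finsupp.single 0 f.natDegree).degree
  rwa [Finsupp.degree_single, Finsupp.degree_single]

theorem cMonicPart_cRel {f : k[X]} (hn : 0 < n) (hf : f.natDegree = n) :
    cMonicPart (cRel f) = f.leadingCoeff⁻¹ • cRel f := by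
  rw [cMonicPart, cLeadCoeff_of_hasLead (monicPart_rel hn hf).1 (hasLead_cRel hf)]

theorem cMonicPart_cRel_of_monic {f : k[X]} (hn : 0 < n) (hf : f.natDegree = n) (h : f.Monic) :
    cMonicPart (cRel f) = cRel f := by
  rw [cMonicPart_cRel hn hf, h.leadingCoeff, inv_one, one_smul]

theorem cDiffIdeal_cMonicPart_cRel {f : k[X]} (hn : 0 < n) (hf : f.natDegree = n) :
    cDiffIdeal lam {cMonicPart (cRel f)} = cDiffIdeal lam {cRel f} := by
  rw [cMonicPart_cRel hn hf, cDiffIdeal_smul (inv_ne_zero (monicPart_rel hn hf).1)]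

theorem hasLead_cMonicPart_cRel {f : k[X]} (hn : 0 < n) (hf : f.natDegree = n) :
    HasLead (monoHom k) MonoMulLT (1 : k) (cRelLead n 0) (cMonicPart (cRel f)) := by
  have := (hasLead_cRel hf).smul f.leadingCoeff⁻¹
  rwa [inv_mul_cancel₀ (monicPart_rel hn hf).1, ← cMonicPart_cRel hn hf] at this

/-! ### Compositions, Gröbner-Shirshov basis and linear basis for commutative monomials -/

theorem mem_cRelIdeal_iff (f : k[X]) {a : k} (ha : a ≠ 0) {p : MvPolynomial ℕ k} :
    p ∈ cRelIdeal lam f ↔ p ∈ Submodule.span k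
      (Set.range fun t : Multiplicative (ℕ →₀ ℕ) × ℕ × Multiplicative (ℕ →₀ ℕ) =>
        monoHom k t.1 * (cDeriv lam)^[t.2.1] (a • cRel f) * monoHom k t.2.2) := by
  have hiter : ∀ m, (cDeriv lam)^[m] (a • cRel f) = a • (cDeriv lam)^[m] (cRel f) := fun m =>
    (apply_iterate_comm (ψ := fun x : MvPolynomial ℕ k => a • x)
      (fun x => ((cDeriv lam).map_smul a x).symm) m (cRel f)).symm
  set N := Submodule.span k
      (Set.range fun t : Multiplicative (ℕ →₀ ℕ) × ℕ × Multiplicative (ℕ →₀ ℕ) =>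
        monoHom k t.1 * (cDeriv lam)^[t.2.1] (a • cRel f) * monoHom k t.2.2) with hN
  have htop : ∀ q : MvPolynomial ℕ k, q ∈ mspan k (monoHom k) Set.univ := by
    intro q
    have : mspan k (monoHom k) Set.univ = ⊤ := by
      rw [mspan, Set.image_univ, ← (monoBasis k).span_eq]
      congr 2
      exact funext fun v => (monoBasis_apply v).symm
    rw [this]
    trivial
  constructor
  · intro hp
    induction hp using Submodule.span_induction with
    | mem x hx =>
      obtain ⟨m, rfl⟩ := hx
      have : (cDeriv lam)^[m] (cRel f) =
          a⁻¹ • (monoHom k 1 * (cDeriv lam)^[m] (a • cRel f) * monoHom k 1) := by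
        rw [map_one, one_mul, mul_one, hiter, smul_smul, inv_mul_cancel₀ ha, one_smul]
      simp only [this]
      exact N.smul_mem _ (Submodule.subset_span ⟨(1, m, 1), rfl⟩)
    | zero => exact N.zero_mem
    | add x y _ _ hx hy => exact N.add_mem hx hy
    | smul q x _ hx =>
      refine map_mem_of_mspan (htop q) (LinearMap.mulRight k x) N fun w _ => ?_
      have : N ≤ N.comap (LinearMap.mulLeft k (monoHom k w)) := by
        rw [hN, Submodule.span_le]
        rintro _ ⟨⟨u, m, v⟩, rfl⟩
        refine Submodule.subset_span ⟨(w * u, m, v), ?_⟩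
        simp only [map_mul, LinearMap.mulLeft_apply, mul_assoc]
      exact this hx
  · intro hp
    induction hp using Submodule.span_induction with
    | zero => exact Ideal.zero_mem _
    | add x y _ _ hx hy => exact Ideal.add_mem _ hx hy
    | smul c x _ hx => rw [MvPolynomial.smul_eq_C_mul]; exact Ideal.mul_mem_left _ _ hx
    | mem x hx =>
      obtain ⟨⟨u, m, v⟩, rfl⟩ := hx
      change monoHom k u * (cDeriv lam)^[m] (a • cRel f) * monoHom k v ∈ cRelIdeal lam f
      rw [hiter, MvPolynomial.smul_eq_C_mul]
      exact Ideal.mul_mem_right _ _ (Ideal.mul_mem_left _ _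
        (Ideal.mul_mem_left _ _ (Ideal.subset_span ⟨m, rfl⟩)))

/-- Powers of distinct variables are coprime, so a common multiple of both has each one dividing the
cofactor of the other. -/
theorem le_of_single_add_eq {i j : ℕ} (hij : i ≠ j) {u v : ℕ →₀ ℕ}
    (h : Finsupp.single i n + u = Finsupp.single j n + v) : Finsupp.single i n ≤ v := by
  rw [Finsupp.single_le_iff]
  have := DFunLike.congr_fun h i
  rw [Finsupp.add_apply, Finsupp.add_apply, Finsupp.single_eq_same,
    Finsupp.single_eq_of_ne hij] at this
  omega

/-- For `i ≠ j` coprimality forces `w` to have degree at least `2 n`, outside the range of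
compositions. For `i = j` the cofactors agree and the composition is zero. -/
theorem isCGSBasis_of_hasLead {c : ℕ → k}
    (hG : HasLead (monoHom k) MonoMulLT (1 : k) (cRelLead n 0) G) (hc : ∀ m, c m ≠ 0)
    (hD : ∀ m, HasLead (monoHom k) MonoMulLT (c m) (cRelLead n m) ((cDeriv lam)^[m] G)) :
    IsCGSBasis lam {G} := by
  have hL : ∀ m, leadMono ((cDeriv lam)^[m] G) = Finsupp.single m n := fun m =>
    leadMono_of_hasLead (hc m) (hD m)
  have hlen : leadMono G = Finsupp.single 0 n := hL 0
  constructor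
  · rintro _ rfl
    exact cLeadCoeff_of_hasLead one_ne_zero hG
  · rintro _ rfl _ rfl i j u v w - - hw hw' hl
    rw [hL] at hw hw'
    rw [hlen, Finsupp.degree_single] at hl
    have h := hw.symm.trans hw'
    by_cases hij : i = j
    · subst hij
      rw [add_left_cancel h, sub_self]
      exact Submodule.zero_mem _
    · have := Finsupp.degree_mono (le_of_single_add_eq hij h)
      rw [Finsupp.degree_single] at this
      rw [hw', map_add, Finsupp.degree_single] at hl
      omega

/-- The linear basis also requires the compositions of large degree. For `i ≠ j` the common multiple
is `L_i t L_j`, and the argument for disjoint occurrences applies after commuting factors. -/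
theorem cComposition {D : ℕ → MvPolynomial ℕ k} {c : ℕ → k} (hc : ∀ m, c m ≠ 0)
    (hD : ∀ m, HasLead (monoHom k) MonoMulLT (c m) (cRelLead n m) (D m))
    (i j : ℕ) (x y x' y' : Multiplicative (ℕ →₀ ℕ))
    (h : x * cRelLead n i * y = x' * cRelLead n j * y') :
    (c i)⁻¹ • (monoHom k x * D i * monoHom k y) - (c j)⁻¹ • (monoHom k x' * D j * monoHom k y') ∈
      smallSpan k (monoHom k) MonoMulLT D (cRelLead n) (x * cRelLead n i * y) := by
  have h1 : cRelLead n i * (x * y) = cRelLead n j * (x' * y') := by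
    rw [← mul_assoc, ← mul_assoc, mul_comm _ x, mul_comm _ x', h]
  have h2 : ∀ (x y : Multiplicative (ℕ →₀ ℕ)) p,
      monoHom k x * p * monoHom k y = p * monoHom k (x * y) := fun x y p => by
    rw [map_mul]
    ring
  rw [h2, h2]
  by_cases hij : i = j
  · subst hij
    rw [mul_left_cancel h1, sub_self]
    exact Submodule.zero_mem _
  obtain ⟨t, ht⟩ : ∃ t, x' * y' = t * cRelLead n i := by
    obtain ⟨t, ht⟩ := exists_add_of_le (le_of_single_add_eq hij (congrArg Multiplicative.toAdd h1))
    exact ⟨Multiplicative.ofAdd t, (show x' * y' = cRelLead n i * Multiplicative.ofAdd t from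
      ht).trans (mul_comm _ _)⟩
  have hxy : x * y = t * cRelLead n j := by
    refine mul_left_cancel (a := cRelLead n i) (h1.trans ?_)
    rw [ht, mul_comm t, mul_left_comm, mul_comm (cRelLead n j) t]
  have := disjoint_composition isMulOrder_monoMulLT hc hD i j t
  have hw : x * cRelLead n i * y = cRelLead n i * t * cRelLead n j := by
    rw [mul_comm x, mul_assoc, hxy, mul_assoc]
  rw [ht, hxy, hw, mul_comm (D j), mul_comm t (cRelLead n i)]
  exact this

/-- The commutative part for nonzero weight: the Gröbner-Shirshov basis, the irreducible monomials,
and the basis. -/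
theorem commutative_groebnerShirshov {f : k[X]} (hn : 0 < n) (hf : f.natDegree = n)
    (hlam : lam ≠ 0) :
    IsCGSBasis lam {cMonicPart (cRel f)} ∧
    CDIrr lam {cMonicPart (cRel f)} = {a : ℕ →₀ ℕ | ∀ i, a i ≤ n - 1} ∧
    ∃ B : Module.Basis (CDIrr lam {cMonicPart (cRel f)}) k (CRelQuotient lam f),
      ∀ a, B a = cProj lam f (mono a.1) := by
  have hG := hasLead_cMonicPart_cRel hn hf
  choose c hc hD using exists_hasLead_cDeriv_iterate hlam hn hG
  have hirr : ∀ w, w ∈ CDIrr lam {cMonicPart (cRel f)} ↔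
      ¬ ∃ m u, w = Finsupp.single m n + u := by
    intro w
    simp only [CDIrr, Set.mem_singleton_iff, exists_eq_left, Set.mem_ofPred_eq,
      leadMono_of_hasLead (hc _) (hD _)]
    refine not_congr (exists_congr fun m => exists_congr fun u => ?_)
    exact and_iff_right (ne_zero_of_hasLead_mono (hc m) (hD m))
  refine ⟨isCGSBasis_of_hasLead hG hc hD, ?_, ?_⟩
  · ext a
    rw [hirr, Set.mem_ofPred_eq, not_exists]
    refine forall_congr' fun i => ?_
    -- Since `n > 0`, not being at least `n` is the same as being at most the truncated difference
    -- `n - 1`.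
    rw [← le_iff_exists_add, Finsupp.single_le_iff]
    omega
  · obtain ⟨B, hB⟩ := exists_basis_of_smallSpan (W := monoHom k) isMulOrder_monoMulLT monoMulLT_wf
      monoMulLT_tri (monoBasis k) monoBasis_apply hc hD (cComposition hc hD)
      (cProj lam f).toLinearMap (cProj_surjective f) (by
        ext p
        rw [cMonicPart_cRel hn hf, ← mem_cRelIdeal_iff f (inv_ne_zero (monicPart_rel hn hf).1)]
        exact cProj_eq_zero f)
      {w | w.toAdd ∈ CDIrr lam {cMonicPart (cRel f)}} (fun w => by
        rw [Set.mem_ofPred_eq, hirr]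
        refine not_congr (exists_congr fun m => ?_)
        constructor
        · rintro ⟨u, hu⟩
          refine ⟨1, Multiplicative.ofAdd u, ?_⟩
          rw [one_mul]
          exact hu
        · rintro ⟨x, y, rfl⟩
          refine ⟨(x * y).toAdd, ?_⟩
          rw [mul_comm x, mul_assoc]
          rfl)
    exact ⟨B.reindex (Multiplicative.toAdd.subtypeEquiv fun _ => Iff.rfl), fun a => by
      rw [Module.Basis.reindex_apply, hB]
      rfl⟩

end Commutative

end WDiff

theorem mainTheorem7 {k : Type u} [Field k] [CharZero k] [DecidableEq k]
    (f : Polynomial k) (n : ℕ) (hn : 0 < n) (hf : f.natDegree = n) :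
    -- noncommutative case, arbitrary weight
    (∀ lam : k,
      -- presentation of the free differential algebra on `k[x]/(f)`
      (∃ (d : WDiff.RelQuotient lam f →ₗ[k] WDiff.RelQuotient lam f)
          (i : AdjoinRoot f →ₐ[k] WDiff.RelQuotient lam f),
        (∀ p, d (WDiff.proj lam f p) = WDiff.proj lam f (WDiff.deriv lam p)) ∧
        i (AdjoinRoot.root f) = WDiff.proj lam f (FreeAlgebra.ι k 0) ∧
        WDiff.IsFreeDiffAlgebra.{v} lam d i) ∧
      -- the relations generate the differential ideal of `f(x^(0))`
      WDiff.relIdeal lam f = WDiff.diffIdeal lam {WDiff.rel f} ∧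
      -- Gröbner-Shirshov basis, with the generator made monic
      (f.Monic → WDiff.monicPart (WDiff.rel f) = WDiff.rel f) ∧
      WDiff.diffIdeal lam {WDiff.monicPart (WDiff.rel f)} = WDiff.diffIdeal lam {WDiff.rel f} ∧
      WDiff.IsGSBasis lam {WDiff.monicPart (WDiff.rel f)} ∧
      -- irreducible words
      WDiff.DIrr lam {WDiff.monicPart (WDiff.rel f)} =
        {w | ∀ m : ℕ, ¬ ∃ a b : FreeMonoid ℕ,
          w = a * (FreeMonoid.of m * FreeMonoid.of (if lam = 0 then 0 else m) ^ (n - 1)) * b} ∧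
      -- they form a basis
      ∃ B : Module.Basis (WDiff.DIrr lam {WDiff.monicPart (WDiff.rel f)}) k
          (WDiff.RelQuotient lam f),
        ∀ w, B w = WDiff.proj lam f (WDiff.word w.1)) ∧
    -- commutative case
    (∀ lam : k,
      -- presentation of the free commutative differential algebra, arbitrary weight
      (∃ (d : WDiff.CRelQuotient lam f →ₗ[k] WDiff.CRelQuotient lam f)
          (i : AdjoinRoot f →ₐ[k] WDiff.CRelQuotient lam f),
        (∀ p, d (WDiff.cProj lam f p) = WDiff.cProj lam f (WDiff.cDeriv lam p)) ∧
        i (AdjoinRoot.root f) = WDiff.cProj lam f (MvPolynomial.X 0) ∧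
        WDiff.IsFreeCommDiffAlgebra.{v} lam d i) ∧
      WDiff.cRelIdeal lam f = WDiff.cDiffIdeal lam {WDiff.cRel f} ∧
      (f.Monic → WDiff.cMonicPart (WDiff.cRel f) = WDiff.cRel f) ∧
      WDiff.cDiffIdeal lam {WDiff.cMonicPart (WDiff.cRel f)} =
        WDiff.cDiffIdeal lam {WDiff.cRel f} ∧
      -- nonzero weight
      (lam ≠ 0 →
        WDiff.IsCGSBasis lam {WDiff.cMonicPart (WDiff.cRel f)} ∧
        WDiff.CDIrr lam {WDiff.cMonicPart (WDiff.cRel f)} =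
          {a : ℕ →₀ ℕ | ∀ i, a i ≤ n - 1} ∧
        ∃ B : Module.Basis (WDiff.CDIrr lam {WDiff.cMonicPart (WDiff.cRel f)}) k
            (WDiff.CRelQuotient lam f),
          ∀ a, B a = WDiff.cProj lam f (WDiff.mono a.1))) := by
  refine ⟨fun lam => ?_, fun lam => ?_⟩
  · obtain ⟨hgs, hirr, hB⟩ := WDiff.noncommutative_groebnerShirshov hn hf lam
    exact ⟨WDiff.exists_presentation lam f, WDiff.relIdeal_eq_diffIdeal f,
      WDiff.monicPart_rel_of_monic hn hf, WDiff.diffIdeal_monicPart_rel hn hf, hgs, hirr, hB⟩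
  · exact ⟨WDiff.exists_cPresentation lam f, WDiff.cRelIdeal_eq_cDiffIdeal f,
      WDiff.cMonicPart_cRel_of_monic hn hf, WDiff.cDiffIdeal_cMonicPart_cRel hn hf,
      WDiff.commutative_groebnerShirshov hn hf⟩
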